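/- Let $D>0$, $D\equiv 0,1 \bmod 4$, be a discriminant that is not a square, and write $D=f^2D_0$ with $D_0$ a fundamental discriminant and $f\ge 1$ (the conductor of $D$). Let $K=\mathbb{Q}(\sqrt D)$ and let $\mathcal{O}_D=\mathbb{Z}\oplus\frac{D+\sqrt D}{2}\mathbb{Z}\subset K$ be the quadratic order of discriminant $D$. For an ideal $\mathfrak{b}$ of $\mathcal{O}_D$ put $\mathfrak{b}^{-1}=\{x\in K : x\mathfrak{b}\subseteq\mathcal{O}_D\}$, let $$\mathrm{SL}(\mathfrak{b}\oplus\mathcal{O}_D^\vee)=\begin{pmatrix}\mathcal{O}_D & \sqrt D\,\mathfrak{b}\\ \frac{1}{\sqrt D}\,\mathfrak{b}^{-1} & \mathcal{O}_D\end{pmatrix}\cap \mathrm{SL}_2(K)$$ act on $\mathbb{H}^2$ by Möbius transformations through the two real embeddings of $K$, and let $X_D(\mathfrak{b})=\mathrm{SL}(\mathfrak{b}\oplus\mathcal{O}_D^\vee)\backslash\mathbb{H}^2$ be the Hilbert modular surface; put $X_D=X_D(\mathcal{O}_D)$. Let $\chi$ denote the orbifold Euler characteristic, that is, the integral of the Gauss–Bonnet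 (Euler) form $$\chi(X_D(\mathfrak{b}))=\int_{X_D(\mathfrak{b})}\frac{1}{2\pi}\frac{dx_1\,dy_1}{y_1^2}\wedge\frac{1}{2\pi}\frac{dx_2\,dy_2}{y_2^2}$$ (over a fundamental domain for the action on $\mathbb{H}^2$). Then for every ideal $\mathfrak{b}$ of $\mathcal{O}_D$ of norm $|\mathcal{O}_D/\mathfrak{b}|=6$ (invertible or not), $$\kappa_D:=\frac{\chi(X_D(\mathfrak{b}))}{\chi(X_D)}=\begin{cases}1 & \text{if }\gcd(6,f)=1,\\ 3/2 & \text{if }\gcd(6,f)=2,\\ 4/3 & \text{if }\gcd(6,f)=3,\\ 2 & \text{if }\gcd(6,f)=6.\end{cases}$$ -/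

import Mathlib

open scoped UpperHalfPlane MatrixGroups

namespace HilbertModular

/-- `D` is a (positive) quadratic discriminant. -/
def IsDiscriminant (D : ℕ) : Prop :=
  0 < D ∧ (D % 4 = 0 ∨ D % 4 = 1)

/-- `D₀` is a (positive) fundamental discriminant. -/
def IsFundamentalDiscriminant (D₀ : ℕ) : Prop :=
  (D₀ % 4 = 1 ∧ Squarefree D₀) ∨
    ∃ m : ℕ, D₀ = 4 * m ∧ (m % 4 = 2 ∨ m % 4 = 3) ∧ Squarefree m

/-- `f` is the conductor of `D`: one has `D = f² D₀` with `D₀` a fundamental discriminant. -/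
def IsConductor (D f : ℕ) : Prop :=
  ∃ D₀ : ℕ, IsFundamentalDiscriminant D₀ ∧ D = f ^ 2 * D₀

/-- The algebra `K = ℚ(√D) = ℚ[ω] / (ω² - D)`; it is a real quadratic field as soon as `D` is
positive and not a square. -/
abbrev QuadField (D : ℕ) : Type := QuadraticAlgebra ℚ (D : ℚ) 0

/-- The element `√D` of `K = ℚ(√D)`. -/
def sqrtD (D : ℕ) : QuadField D := ⟨0, 1⟩

/-- The element `γ_D = (D + √D) / 2` of `K`. -/
def gammaD (D : ℕ) : QuadField D := ⟨(D : ℚ) / 2, 1 / 2⟩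

/-- The quadratic order `𝓞_D = ℤ[γ_D]`, which is `ℤ ⊕ γ_D ℤ` for a discriminant `D`. -/
def quadOrder (D : ℕ) : Subalgebra ℤ (QuadField D) :=
  Algebra.adjoin ℤ {gammaD D}

/-- The embedding `K → ℝ` that sends `√D` to a given real square root `s` of `D`. -/
noncomputable def realEmbedding (D : ℕ) (s : ℝ) (hs : s * s = D) : QuadField D →+* ℝ :=
  (QuadraticAlgebra.lift (R := ℚ) (a := (D : ℚ)) (b := 0) (A := ℝ)
    ⟨s, by simp [hs, Algebra.smul_def]⟩).toRingHom

/-- The first real embedding of `K`, with `√D ↦ √D`. -/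
noncomputable def σ₁ (D : ℕ) : QuadField D →+* ℝ :=
  realEmbedding D (√(D : ℝ)) (Real.mul_self_sqrt (Nat.cast_nonneg D))

/-- The second (Galois conjugate) real embedding of `K`, with `√D ↦ -√D`. -/
noncomputable def σ₂ (D : ℕ) : QuadField D →+* ℝ :=
  realEmbedding D (-√(D : ℝ)) (by
    rw [neg_mul_neg]; exact Real.mul_self_sqrt (Nat.cast_nonneg D))

/-- The inverse ideal `𝔟⁻¹ = {x ∈ K | x 𝔟 ⊆ 𝓞_D}` of an `𝓞_D`-ideal `𝔟`. -/
def idealInverse {D : ℕ} (𝔟 : Ideal (quadOrder D)) : Set (QuadField D) :=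
  {x | ∀ y ∈ 𝔟, x * (y : QuadField D) ∈ quadOrder D}

/-- The Hilbert modular group `SL(𝔟 ⊕ 𝓞_D^∨)`: all matrices in `SL₂(K)` with diagonal entries in
`𝓞_D`, upper right entry in `√D 𝔟` and lower left entry in `(1/√D) 𝔟⁻¹`. -/
def hilbertModularGroup {D : ℕ} (𝔟 : Ideal (quadOrder D)) : Subgroup SL(2, QuadField D) where
  carrier := {g | g 0 0 ∈ quadOrder D ∧ g 1 1 ∈ quadOrder D ∧
    (∃ y ∈ 𝔟, g 0 1 = sqrtD D * (y : QuadField D)) ∧ sqrtD D * g 1 0 ∈ idealInverse 𝔟}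
  one_mem' := by
    refine ⟨by simp, by simp, ⟨0, 𝔟.zero_mem, by simp⟩, ?_⟩
    intro y _
    simp
  mul_mem' := by
    rintro g h ⟨ga, gd, ⟨x, hx, gb⟩, gc⟩ ⟨ha, hd, ⟨y, hy, hb⟩, hc⟩
    refine ⟨?_, ?_, ⟨⟨_, ga⟩ * y + ⟨_, hd⟩ * x, ?_, ?_⟩, ?_⟩
    · rw [Matrix.SpecialLinearGroup.coe_mul, Matrix.mul_apply, Fin.sum_univ_two, gb]
      refine add_mem (mul_mem ga ha) ?_
      convert hc x hx using 1
      ring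
    · rw [Matrix.SpecialLinearGroup.coe_mul, Matrix.mul_apply, Fin.sum_univ_two, hb]
      refine add_mem ?_ (mul_mem gd hd)
      convert gc y hy using 1
      ring
    · exact 𝔟.add_mem (𝔟.mul_mem_left _ hy) (𝔟.mul_mem_left _ hx)
    · rw [Matrix.SpecialLinearGroup.coe_mul, Matrix.mul_apply, Fin.sum_univ_two, gb, hb]
      push_cast
      ring
    · intro z hz
      rw [Matrix.SpecialLinearGroup.coe_mul, Matrix.mul_apply, Fin.sum_univ_two]
      have h1 := gc (⟨_, ha⟩ * z) (𝔟.mul_mem_left _ hz)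
      have h2 := hc (⟨_, gd⟩ * z) (𝔟.mul_mem_left _ hz)
      convert add_mem h1 h2 using 1
      push_cast
      ring
  inv_mem' := by
    rintro g ⟨ga, gd, ⟨x, hx, gb⟩, gc⟩
    rw [Set.mem_ofPred_eq, Matrix.SpecialLinearGroup.SL2_inv_expl]
    refine ⟨by simpa using gd, by simpa using ga, ⟨-x, 𝔟.neg_mem hx, by simp [gb]⟩, ?_⟩
    intro z hz
    simpa using neg_mem (gc z hz)

/-- The action of `SL₂(K)` on `ℍ²` by Möbius transformations through the two real embeddings:
`g • (z₁, z₂) = (σ₁(g) • z₁, σ₂(g) • z₂)`. -/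
noncomputable def moebius (D : ℕ) : SL(2, QuadField D) →* Equiv.Perm (ℍ × ℍ) where
  toFun g := Equiv.prodCongr
    (MulAction.toPerm (Matrix.SpecialLinearGroup.map (σ₁ D) g : SL(2, ℝ)))
    (MulAction.toPerm (Matrix.SpecialLinearGroup.map (σ₂ D) g : SL(2, ℝ)))
  map_one' := by
    ext z <;> simp
  map_mul' g h := by
    ext z <;> simp [mul_smul]

/-- The group of transformations of `ℍ²` whose quotient orbifold is the Hilbert modular surface
`X_D(𝔟) = SL(𝔟 ⊕ 𝓞_D^∨) \ ℍ²`: the image of `SL(𝔟 ⊕ 𝓞_D^∨)` in the permutations of `ℍ²`. (Passing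
to the image removes the matrix `-1`, which acts trivially.) -/
noncomputable def transformationGroup {D : ℕ} (𝔟 : Ideal (quadOrder D)) :
    Subgroup (Equiv.Perm (ℍ × ℍ)) :=
  (hilbertModularGroup 𝔟).map (moebius D)

/-- The Euler (Gauss–Bonnet) measure of `ℍ²` for the product of the hyperbolic metrics: the
measure of the Euler form `(1/2π) dx₁dy₁/y₁² ∧ (1/2π) dx₂dy₂/y₂²`. (Mathlib's `volume` on `ℍ` is
`dx dy / y²`.) -/
noncomputable def eulerMeasure : MeasureTheory.Measure (ℍ × ℍ) :=
  (ENNReal.ofReal (1 / (2 * Real.pi)) • (MeasureTheory.volume : MeasureTheory.Measure ℍ)).prod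
    (ENNReal.ofReal (1 / (2 * Real.pi)) • (MeasureTheory.volume : MeasureTheory.Measure ℍ))

/-- The orbifold Euler characteristic `χ(X_D(𝔟))`: the integral of the Euler form over the quotient
orbifold `X_D(𝔟)`, i.e. the Euler measure of a fundamental domain of the transformation group. -/
noncomputable def eulerChar {D : ℕ} (𝔟 : Ideal (quadOrder D)) : ℝ :=
  (MeasureTheory.covolume (transformationGroup 𝔟) (ℍ × ℍ) eulerMeasure).toReal

/-- The norm of an `𝓞_D`-ideal: its index in `𝓞_D`. -/
noncomputable def idealNorm {D : ℕ} (𝔟 : Ideal (quadOrder D)) : ℕ :=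
  Submodule.cardQuot 𝔟

end HilbertModular

/-! A ring with six elements is `ZMod 6`, so an ideal of norm 6 is 𝔭₂ ∩ 𝔭₃ with 𝔭₂, 𝔭₃ the kernels
of ring homomorphisms to 𝔽₂ and 𝔽₃; invertibility plays no role. It suffices to compare Γ(𝔞) with
Γ(𝔞 ∩ 𝔭) for 𝔭 of norm p coprime to 𝔞, and to apply this along 𝓞_D ⊃ 𝔭₂ ⊃ 𝔭₂ ∩ 𝔭₃. Both groups
contain Γ(𝔞) ∩ Γ(𝔞 ∩ 𝔭), so the ratio of their covolumes is a quotient of two indices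
(`mul_covolume_eq`).

In Γ(𝔞) the intersection is cut out by a condition on the upper right entry; the top row modulo 𝔭
identifies the cosets with P¹(𝔽_p), so the index is p + 1 (`hasCosetReps_inf_left`). In Γ(𝔞 ∩ 𝔭) the
condition is on the lower left entry, read in the line (𝔞 ∩ 𝔭)⁻¹/𝔞⁻¹ over 𝔽_p (`exists_residueMap`),
and the bottom row again gives a point of P¹(𝔽_p). If 𝔭𝔭⁻¹ is not contained in 𝔭, all p + 1 points
occur. If 𝔭𝔭⁻¹ ⊆ 𝔭, the determinant forces the lower right entry to be a unit modulo 𝔭 and only the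
p points of an affine line occur. The second case happens exactly when p divides f
(`two_dvd_conductor_iff`, `three_dvd_conductor_iff`). So p contributes (p + 1)/p to κ_D if p ∣ f,
and 1 otherwise.

The division makes sense because the covolume for 𝓞_D is neither zero nor infinite. Fundamental
domains exist since the action is properly discontinuous and fixed point sets are null. Finiteness
is reduction theory: units balance the two imaginary parts, Dirichlet approximation moves points
away from the boundary, and finitely many translates of a Siegel set of finite measure meet every
orbit (`exists_covering_set`). -/

namespace HilbertModular

open MeasureTheory
open scoped Pointwise ENNReal

/-! ### Existence and comparison of fundamental domains -/

section FundamentalDomains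

variable {G α : Type*} [Group G] [MulAction G α]

/-- Countably many wandering measurable sets that cover almost every orbit can be pruned to a
fundamental domain. -/
theorem exists_isFundamentalDomain_of_wandering [Countable G] [MeasurableSpace α]
    [MeasurableConstSMul G α] (μ : Measure α) (U : ℕ → Set α) (hU : ∀ n, MeasurableSet (U n))
    (hdisj : ∀ n, ∀ g : G, g ≠ 1 → Disjoint (g • U n) (U n))
    (hcov : ∀ᵐ x ∂μ, ∃ n, x ∈ U n) :
    ∃ s : Set α, IsFundamentalDomain G s μ := by
  classical
  -- Each orbit is kept only in the first `U n` that it meets.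
  refine ⟨⋃ n, (U n \ ⋃ m, ⋃ (_ : m < n), ⋃ g : G, g • U m), ?_, ?_, ?_⟩
  · refine (MeasurableSet.iUnion fun n => (hU n).diff ?_).nullMeasurableSet
    refine MeasurableSet.iUnion fun m => MeasurableSet.iUnion fun _ => MeasurableSet.iUnion fun g =>
      (hU m).const_smul g
  · filter_upwards [hcov] with x hx
    have hx' : ∃ n, ∃ g : G, g • x ∈ U n := by
      obtain ⟨n, hn⟩ := hx
      exact ⟨n, 1, by simpa using hn⟩
    obtain ⟨g, hg⟩ := Nat.find_spec hx'
    refine ⟨g, Set.mem_iUnion.2 ⟨Nat.find hx', hg, ?_⟩⟩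
    simp only [Set.mem_iUnion, not_exists]
    intro m hm h hgx
    refine Nat.find_min hx' hm ⟨h⁻¹ * g, ?_⟩
    rw [mul_smul]
    exact Set.mem_smul_set_iff_inv_smul_mem.1 hgx
  · have key : ∀ g : G, g ≠ 1 → Disjoint
        (g • ⋃ n, (U n \ ⋃ m, ⋃ (_ : m < n), ⋃ g : G, g • U m))
        (⋃ n, (U n \ ⋃ m, ⋃ (_ : m < n), ⋃ g : G, g • U m)) := by
      intro g hg
      rw [Set.disjoint_left]
      intro x hx hx'
      rw [Set.mem_smul_set_iff_inv_smul_mem] at hx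
      obtain ⟨n, hn, hn'⟩ := Set.mem_iUnion.1 hx
      obtain ⟨m, hm, hm'⟩ := Set.mem_iUnion.1 hx'
      simp only [Set.mem_iUnion, not_exists] at hn' hm'
      rcases lt_trichotomy n m with h | h | h
      · exact hm' n h g (Set.mem_smul_set_iff_inv_smul_mem.2 hn)
      · subst h
        exact Set.disjoint_left.1 (hdisj n g hg) (Set.mem_smul_set_iff_inv_smul_mem.2 hn) hm
      · exact hn' m h g⁻¹ (by simpa using hm)
    intro g h hgh
    refine Disjoint.aedisjoint ?_
    have h1 : h⁻¹ * g ≠ 1 := fun h0 => hgh (by rw [inv_mul_eq_one] at h0; exact h0.symm)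
    have := key _ h1
    rw [Set.disjoint_left] at this ⊢
    intro x hx hx'
    refine this (a := h⁻¹ • x) ?_ (Set.mem_smul_set_iff_inv_smul_mem.1 hx')
    rw [mul_smul]
    exact Set.smul_mem_smul_set hx

/-- A properly discontinuous action of a countable group for which nontrivial elements have null
fixed point sets has a fundamental domain. -/
theorem exists_isFundamentalDomain_of_properlyDiscontinuousSMul [Countable G] [TopologicalSpace α]
    [SecondCountableTopology α] [T2Space α] [LocallyCompactSpace α] [MeasurableSpace α]
    [BorelSpace α] [ContinuousConstSMul G α] [ProperlyDiscontinuousSMul G α] (μ : Measure α)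
    (hfix : ∀ g : G, g ≠ 1 → μ {x | g • x = x} = 0) :
    ∃ s : Set α, IsFundamentalDomain G s μ := by
  classical
  have hloc : ∀ x : α, (∀ g : G, g ≠ 1 → g • x ≠ x) →
      ∃ U : Set α, IsOpen U ∧ x ∈ U ∧ ∀ g : G, g ≠ 1 → Disjoint (g • U) U := by
    intro x hx
    obtain ⟨K, hK, hxK⟩ := exists_compact_mem_nhds x
    -- Only finitely many group elements can move a point of `K` back into `K`, so a finite
    -- intersection of separating neighbourhoods suffices.
    have hfin := finite_disjoint_inter_image (Γ := G) hK hK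
    have hsep : ∀ g : G, g ≠ 1 → ∃ V : Set α, IsOpen V ∧ x ∈ V ∧ Disjoint (g • V) V := by
      intro g hg
      obtain ⟨A, B, hA, hB, hxA, hxB, hAB⟩ := t2_separation (hx g hg)
      refine ⟨(fun y => g • y) ⁻¹' A ∩ B, (hA.preimage (continuous_const_smul g)).inter hB,
        ⟨hxA, hxB⟩, ?_⟩
      rw [Set.disjoint_left]
      rintro _ ⟨y, hy, rfl⟩ hy'
      exact Set.disjoint_left.1 hAB hy.1 hy'.2
    choose! V hVo hxV hVd using hsep
    refine ⟨interior K ∩ ⋂ g ∈ hfin.toFinset.erase 1, V g,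
      isOpen_interior.inter (isOpen_biInter_finset fun g hg => hVo g (Finset.ne_of_mem_erase hg)),
      ⟨mem_interior_iff_mem_nhds.2 hxK, ?_⟩, ?_⟩
    · simp only [Set.mem_iInter]
      exact fun g hg => hxV g (Finset.ne_of_mem_erase hg)
    · intro g hg
      rw [Set.disjoint_left]
      rintro _ ⟨y, hy, rfl⟩ hy'
      have hgm : g ∈ hfin.toFinset.erase 1 := by
        refine Finset.mem_erase.2 ⟨hg, hfin.mem_toFinset.2 ?_⟩
        have hne : (((g • ·) '' K) ∩ K).Nonempty :=
          ⟨g • y, ⟨y, interior_subset hy.1, rfl⟩, interior_subset hy'.1⟩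
        exact hne
      have h1 := Set.mem_iInter₂.1 hy.2 g hgm
      have h2 := Set.mem_iInter₂.1 hy'.2 g hgm
      exact Set.disjoint_left.1 (hVd g hg) (Set.smul_mem_smul_set h1) h2
  set B := TopologicalSpace.countableBasis α
  set C : Set (Set α) := {U ∈ B | ∀ g : G, g ≠ 1 → Disjoint (g • U) U}
  have hC : C.Countable := (TopologicalSpace.countable_countableBasis α).mono fun _ h => h.1
  obtain ⟨U, hU⟩ := (hC.insert ∅).exists_eq_range (Set.insert_nonempty _ _)
  have hUm : ∀ n, U n = ∅ ∨ U n ∈ C := fun n => by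
    have : U n ∈ insert ∅ C := hU ▸ Set.mem_range_self n
    simpa using this
  refine exists_isFundamentalDomain_of_wandering μ U (fun n => ?_) (fun n g hg => ?_) ?_
  · rcases hUm n with h | h
    · rw [h]; exact MeasurableSet.empty
    · exact (TopologicalSpace.isOpen_of_mem_countableBasis h.1).measurableSet
  · rcases hUm n with h | h
    · simp [h]
    · exact h.2 g hg
  · have : ∀ᵐ x ∂μ, ∀ g : G, g ≠ 1 → g • x ≠ x := by
      rw [ae_all_iff]
      intro g
      by_cases hg : g = 1
      · simp [hg]
      · have := hfix g hg
        rw [measure_eq_zero_iff_ae_notMem] at this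
        filter_upwards [this] with x hx _ using hx
    filter_upwards [this] with x hx
    obtain ⟨W, hWo, hxW, hWd⟩ := hloc x hx
    obtain ⟨V, hV, hxV, hVW⟩ := (TopologicalSpace.isBasis_countableBasis α).exists_subset_of_mem_open
      hxW hWo
    have hVC : V ∈ insert ∅ C := Set.mem_insert_of_mem _ ⟨hV, fun g hg =>
      (hWd g hg).mono (Set.smul_set_mono hVW) hVW⟩
    rw [hU] at hVC
    obtain ⟨n, rfl⟩ := hVC
    exact ⟨n, hxV⟩

/-- A set that meets every orbit is at least as large as a fundamental domain. -/
theorem measure_le_of_forall_exists_smul_mem [Countable G] [MeasurableSpace α]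
    [MeasurableConstSMul G α] {μ : Measure α} [SMulInvariantMeasure G α μ] {s t : Set α}
    (hs : IsFundamentalDomain G s μ) (ht : ∀ x : α, ∃ g : G, g • x ∈ t) : μ s ≤ μ t := by
  rw [hs.measure_eq_tsum t]
  refine le_trans (measure_mono ?_) (measure_iUnion_le _)
  intro x hx
  obtain ⟨g, hg⟩ := ht x
  exact Set.mem_iUnion.2 ⟨g⁻¹, Set.mem_smul_set_iff_inv_smul_mem.2 (by simpa using hg), hx⟩

end FundamentalDomains

/-- The fundamental domain of a finite index subgroup, in terms of coset representatives. -/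
theorem exists_isFundamentalDomain_subgroup {A α ι : Type*} [Group A] [Fintype ι]
    [MeasurableSpace α] {μ : Measure α} (φ : A →* Equiv.Perm α) {H G : Subgroup A} (hHG : H ≤ G)
    (hker : φ.ker ≤ H) [Countable (G.map φ)]
    (hφ : ∀ g ∈ G, MeasurePreserving (φ g) μ μ)
    (r : ι → A) (hr : ∀ i, r i ∈ G) (hex : ∀ g ∈ G, ∃ i, g * (r i)⁻¹ ∈ H)
    (huniq : ∀ i j, r i * (r j)⁻¹ ∈ H → i = j)
    {s : Set α} (hs : IsFundamentalDomain (G.map φ) s μ) :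
    ∃ t : Set α, IsFundamentalDomain (H.map φ) t μ ∧ μ t = Fintype.card ι * μ s := by
  have hme : ∀ g ∈ G, MeasurableEmbedding (φ g) := fun g hg => by
    have h1 : Measurable (φ g) := (hφ g hg).measurable
    have h2 : Measurable (φ g).symm := by
      have := (hφ g⁻¹ (inv_mem hg)).measurable
      rwa [map_inv] at this
    exact MeasurableEquiv.measurableEmbedding ⟨φ g, h1, h2⟩
  have hpre : ∀ g ∈ G, ∀ u : Set α, φ g '' u = φ g⁻¹ ⁻¹' u := fun g hg u => by
    rw [map_inv, Equiv.image_eq_preimage_symm]; rfl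
  have hnull : ∀ g ∈ G, NullMeasurableSet (φ g '' s) μ := fun g hg => by
    rw [hpre g hg]
    exact hs.nullMeasurableSet.preimage (hφ _ (inv_mem hg)).quasiMeasurePreserving
  have hmeas : ∀ g ∈ G, μ (φ g '' s) = μ s := fun g hg => by
    rw [hpre g hg]
    exact (hφ _ (inv_mem hg)).measure_preimage hs.nullMeasurableSet
  have hdisj : ∀ g ∈ G, ∀ h ∈ G, φ g ≠ φ h → AEDisjoint μ (φ g '' s) (φ h '' s) := by
    intro g hg h hh hgh
    exact hs.aedisjoint (i := ⟨φ g, Subgroup.mem_map_of_mem φ hg⟩)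
      (j := ⟨φ h, Subgroup.mem_map_of_mem φ hh⟩) (fun h0 => hgh (congrArg Subtype.val h0))
  have hmul : ∀ g h : A, ∀ u : Set α, φ g '' (φ h '' u) = φ (g * h) '' u := fun g h u => by
    rw [map_mul, ← Set.image_comp]; rfl
  -- Since `φ.ker ≤ H`, distinct cosets of `H` stay distinct after applying `φ`.
  have hrr : ∀ i j, ∀ h ∈ H, φ (h * r i) = φ (r j) → i = j := by
    intro i j h hh h0
    refine huniq i j ?_
    have h1 : (h * r i) * (r j)⁻¹ ∈ φ.ker := by
      rw [MonoidHom.mem_ker, map_mul, h0, map_inv, mul_inv_cancel]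
    have h2 := mul_mem (inv_mem hh) (hker h1)
    simpa [mul_assoc] using h2
  refine ⟨⋃ i, φ (r i) '' s, ⟨?_, ?_, ?_⟩, ?_⟩
  · exact NullMeasurableSet.iUnion fun i => hnull _ (hr i)
  · filter_upwards [hs.ae_covers] with x hx
    obtain ⟨⟨_, g, hg, rfl⟩, hgx⟩ := hx
    obtain ⟨i, hi⟩ := hex _ (inv_mem hg)
    refine ⟨⟨φ (g⁻¹ * (r i)⁻¹)⁻¹, Subgroup.mem_map_of_mem φ (inv_mem hi)⟩, ?_⟩
    refine Set.mem_iUnion.2 ⟨i, φ g x, hgx, ?_⟩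
    change φ (r i) (φ g x) = φ (g⁻¹ * (r i)⁻¹)⁻¹ x
    rw [mul_inv_rev, inv_inv, inv_inv, map_mul]
    rfl
  · rintro ⟨_, g, hg, rfl⟩ ⟨_, h, hh, rfl⟩ hne
    have hne' : φ g ≠ φ h := fun h0 => hne (Subtype.ext h0)
    change AEDisjoint μ (φ g '' _) (φ h '' _)
    rw [Set.image_iUnion, Set.image_iUnion]
    refine AEDisjoint.iUnion_left_iff.2 fun i => AEDisjoint.iUnion_right_iff.2 fun j => ?_
    rw [hmul, hmul]
    refine hdisj _ (mul_mem (hHG hg) (hr i)) _ (mul_mem (hHG hh) (hr j)) fun h0 => hne' ?_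
    have hij : i = j := by
      refine hrr i j (h⁻¹ * g) (mul_mem (inv_mem hh) hg) ?_
      rw [mul_assoc, map_mul, h0, ← map_mul]
      simp
    subst hij
    simpa using h0
  · rw [measure_iUnion₀ (fun i j hij => ?_) (fun i => hnull _ (hr i)), tsum_fintype]
    · simp [hmeas _ (hr _)]
    · refine hdisj _ (hr i) _ (hr j) fun h0 => hij ?_
      exact hrr i j 1 (one_mem _) (by simpa using h0)

/-! ### The order in the basis 1, γ_D -/

section Coordinates

variable {D : ℕ}

/-- γ_D has trace D and norm N = (D² - D)/4. This relation drives all later coordinate computations.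
-/
theorem gammaD_mul_self (N : ℤ) (hN : 4 * N = (D : ℤ) ^ 2 - D) :
    gammaD D * gammaD D = (D : QuadField D) * gammaD D - (N : QuadField D) := by
  have h : (4 : ℚ) * N = (D : ℚ) ^ 2 - D := by exact_mod_cast hN
  ext
  · simp [gammaD]
    linarith
  · simp [gammaD]
    ring

theorem exists_normForm (hD : IsDiscriminant D) : ∃ N : ℤ, 4 * N = (D : ℤ) ^ 2 - D := by
  have h : (4 : ℤ) ∣ (D : ℤ) ^ 2 - D := by
    have h4 : ((D : ℤ) % 4 = 0 ∨ (D : ℤ) % 4 = 1) := by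
      have := hD.2
      omega
    rcases h4 with h | h <;> refine Int.dvd_of_emod_eq_zero ?_ <;>
      simp [pow_two, Int.sub_emod, Int.mul_emod, h]
  obtain ⟨N, hN⟩ := h
  exact ⟨N, hN.symm⟩

theorem mem_quadOrder_iff (hD : IsDiscriminant D) {x : QuadField D} :
    x ∈ quadOrder D ↔ ∃ u v : ℤ, x = (u : QuadField D) + (v : QuadField D) * gammaD D := by
  constructor
  · intro hx
    obtain ⟨N, hN⟩ := exists_normForm hD
    have hγ := gammaD_mul_self N hN
    induction hx using Algebra.adjoin_induction with
    | mem x hx =>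
      rw [Set.mem_singleton_iff] at hx
      exact ⟨0, 1, by simp [hx]⟩
    | algebraMap n => exact ⟨n, 0, by simp⟩
    | add x y _ _ hx hy =>
      obtain ⟨u, v, rfl⟩ := hx
      obtain ⟨u', v', rfl⟩ := hy
      exact ⟨u + u', v + v', by push_cast; ring⟩
    | mul x y _ _ hx hy =>
      obtain ⟨u, v, rfl⟩ := hx
      obtain ⟨u', v', rfl⟩ := hy
      refine ⟨u * u' - v * v' * N, u * v' + v * u' + v * v' * D, ?_⟩
      push_cast
      linear_combination (v : QuadField D) * v' * hγ
  · rintro ⟨u, v, rfl⟩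
    refine add_mem (intCast_mem _ u) (mul_mem (intCast_mem _ v) ?_)
    exact Algebra.subset_adjoin rfl

theorem intCast_add_mul_gammaD_inj {u v u' v' : ℤ}
    (h : (u : QuadField D) + v * gammaD D = u' + v' * gammaD D) : u = u' ∧ v = v' := by
  have h1 := congrArg QuadraticAlgebra.im h
  have h2 := congrArg QuadraticAlgebra.re h
  simp [gammaD] at h1 h2
  subst h1
  simpa using h2

theorem gammaD_mem : gammaD D ∈ quadOrder D := Algebra.subset_adjoin rfl

/-- The inverse of `√D` in `K`. -/
def sqrtDInv (D : ℕ) : QuadField D := ⟨0, 1 / D⟩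

theorem sqrtD_mul_sqrtDInv (hD : IsDiscriminant D) : sqrtD D * sqrtDInv D = 1 := by
  have : (D : ℚ) ≠ 0 := by exact_mod_cast hD.1.ne'
  ext <;> simp [sqrtD, sqrtDInv, this, QuadraticAlgebra.re_one, QuadraticAlgebra.im_one]

/-- The coefficient `v` of an element `u + v γ_D` of the order. -/
def gammaCoeff (x : QuadField D) : ℤ := (2 * x.im).num

@[simp] theorem gammaCoeff_intCast_add (u v : ℤ) :
    gammaCoeff ((u : QuadField D) + (v : QuadField D) * gammaD D) = v := by
  have : (2 : ℚ) * ((u : QuadField D) + (v : QuadField D) * gammaD D).im = v := by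
    simp [gammaD]
    ring
  rw [gammaCoeff, this]
  simp

theorem intCast_ne_zero {n : ℤ} (hn : n ≠ 0) {x : QuadField D} (h : (n : QuadField D) * x = 0) :
    x = 0 := by
  have h1 := congrArg QuadraticAlgebra.im h
  have h2 := congrArg QuadraticAlgebra.re h
  simp [hn] at h1 h2
  ext <;> simp [h1, h2]

end Coordinates

/-! ### Cosets classified by points of a projective line over 𝔽_p -/

section CosetRepresentatives

variable {A : Type*} [Group A]

/-- `H` has index `n` in `G`, witnessed by right coset representatives. -/
def HasCosetReps (H G : Subgroup A) (n : ℕ) : Prop :=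
  ∃ r : Fin n → A, (∀ i, r i ∈ G) ∧ (∀ g ∈ G, ∃ i, g * (r i)⁻¹ ∈ H) ∧
    ∀ i j, r i * (r j)⁻¹ ∈ H → i = j

theorem HasCosetReps.of_fintype {ι : Type*} [Fintype ι] {H G : Subgroup A} (r : ι → A)
    (hr : ∀ i, r i ∈ G) (hex : ∀ g ∈ G, ∃ i, g * (r i)⁻¹ ∈ H)
    (huniq : ∀ i j, r i * (r j)⁻¹ ∈ H → i = j) : HasCosetReps H G (Fintype.card ι) := by
  refine ⟨r ∘ (Fintype.equivFin ι).symm, fun i => hr _, fun g hg => ?_, fun i j hij => ?_⟩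
  · obtain ⟨i, hi⟩ := hex g hg
    exact ⟨Fintype.equivFin ι i, by simpa using hi⟩
  · exact (Fintype.equivFin ι).symm.injective (huniq _ _ hij)

variable {p : ℕ} [Fact p.Prime] {H G : Subgroup A} (α β : A → ZMod p)
  (hH : ∀ g ∈ G, ∀ h ∈ G, g * h⁻¹ ∈ H ↔ α g * β h = α h * β g)

include hH in
-- By `hH`, a coset is determined by the point [α : β]. Here α never vanishes, so β/α is a complete
-- invariant with p values.
theorem HasCosetReps.of_affineLine (hα : ∀ g ∈ G, α g ≠ 0) (u : ZMod p → A)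
    (hu : ∀ j, u j ∈ G) (hα1 : ∀ j, α (u j) = 1) (hβ : ∀ j, β (u j) = j) :
    HasCosetReps H G p := by
  have := HasCosetReps.of_fintype (H := H) u hu (fun g hg => ⟨β g / α g, ?_⟩) (fun i j hij => ?_)
  · rwa [ZMod.card] at this
  · rw [hH g hg _ (hu _), hα1, hβ, one_mul, mul_div_cancel₀ _ (hα g hg)]
  · rw [hH _ (hu i) _ (hu j), hα1, hα1, hβ, hβ, one_mul, one_mul] at hij
    exact hij.symm

include hH in
-- The invariant [α : β] now also takes the value [0 : 1], at `w`; `h0` ensures that it is a genuine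
-- projective point.
theorem HasCosetReps.of_projectiveLine (h0 : ∀ g ∈ G, α g = 0 → β g ≠ 0) (u : ZMod p → A)
    (hu : ∀ j, u j ∈ G) (hα1 : ∀ j, α (u j) = 1) (hβ : ∀ j, β (u j) = j) (w : A) (hw : w ∈ G)
    (hαw : α w = 0) : HasCosetReps H G (p + 1) := by
  have hr : ∀ i : Option (ZMod p), i.elim w u ∈ G := fun i => by
    cases i with
    | none => exact hw
    | some j => exact hu j
  have := HasCosetReps.of_fintype (H := H) (fun i : Option (ZMod p) => i.elim w u) hr
    (fun g hg => ?_) (fun i j hij => ?_)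
  · rwa [Fintype.card_option, ZMod.card] at this
  · by_cases hg0 : α g = 0
    · exact ⟨none, by rw [Option.elim_none, hH g hg _ hw, hg0, hαw]; simp⟩
    · refine ⟨some (β g / α g), ?_⟩
      rw [Option.elim_some, hH g hg _ (hu _), hα1, hβ, one_mul, mul_div_cancel₀ _ hg0]
  · rw [hH _ (hr i) _ (hr j)] at hij
    cases i with
    | none =>
      cases j with
      | none => rfl
      | some j => simp [hαw, hα1] at hij; exact absurd hij.symm (h0 w hw hαw)
    | some i =>
      cases j with
      | none => simp [hαw, hα1] at hij; exact absurd hij (h0 w hw hαw)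
      | some j => simp [hα1, hβ] at hij; rw [hij]

end CosetRepresentatives

/-! ### Residue maps at a prime of norm p -/

section Residues

variable {D : ℕ} {p : ℕ}

open Classical in
/-- The extension by zero to `K` of a map on the order. -/
noncomputable def extendZero (π : quadOrder D →+* ZMod p) (x : QuadField D) : ZMod p :=
  if h : x ∈ quadOrder D then π ⟨x, h⟩ else 0

variable (π : quadOrder D →+* ZMod p)

@[simp] theorem extendZero_coe (x : quadOrder D) : extendZero π (x : QuadField D) = π x := by
  simp [extendZero]

theorem extendZero_of_mem {x : QuadField D} (hx : x ∈ quadOrder D) :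
    extendZero π x = π ⟨x, hx⟩ := extendZero_coe π ⟨x, hx⟩

theorem extendZero_mul {x y : QuadField D} (hx : x ∈ quadOrder D) (hy : y ∈ quadOrder D) :
    extendZero π (x * y) = extendZero π x * extendZero π y := by
  rw [extendZero_of_mem π hx, extendZero_of_mem π hy, ← map_mul, ← extendZero_coe]
  rfl

theorem extendZero_add {x y : QuadField D} (hx : x ∈ quadOrder D) (hy : y ∈ quadOrder D) :
    extendZero π (x + y) = extendZero π x + extendZero π y := by
  rw [extendZero_of_mem π hx, extendZero_of_mem π hy, ← map_add, ← extendZero_coe]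
  rfl

theorem extendZero_sub {x y : QuadField D} (hx : x ∈ quadOrder D) (hy : y ∈ quadOrder D) :
    extendZero π (x - y) = extendZero π x - extendZero π y := by
  rw [extendZero_of_mem π hx, extendZero_of_mem π hy, ← map_sub, ← extendZero_coe]
  rfl

@[simp] theorem extendZero_intCast (n : ℤ) : extendZero π (n : QuadField D) = n := by
  rw [extendZero_of_mem π (intCast_mem _ n)]
  exact map_intCast π n

@[simp] theorem extendZero_one : extendZero π (1 : QuadField D) = 1 := by
  simpa using extendZero_intCast π 1

variable {r : ℤ} (hr : extendZero π (gammaD D) = r)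

include hr in
theorem extendZero_intCast_add (u v : ℤ) :
    extendZero π ((u : QuadField D) + v * gammaD D) = u + v * r := by
  rw [extendZero_add π (intCast_mem _ u) (mul_mem (intCast_mem _ v) gammaD_mem),
    extendZero_mul π (intCast_mem _ v) gammaD_mem, hr]
  simp

include hr in
-- The residue r of γ_D is a root modulo p of its characteristic polynomial X² - DX + N.
theorem dvd_normForm {N : ℤ} (hN : 4 * N = (D : ℤ) ^ 2 - D) :
    (p : ℤ) ∣ r ^ 2 - D * r + N := by
  have h := congrArg (extendZero π) (gammaD_mul_self N hN)
  rw [extendZero_mul π gammaD_mem gammaD_mem, hr, show (D : QuadField D) * gammaD D - N =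
    ((-N : ℤ) : QuadField D) + (D : ℤ) * gammaD D by push_cast; ring,
    extendZero_intCast_add π hr] at h
  rw [← ZMod.intCast_zmod_eq_zero_iff_dvd]
  push_cast at h ⊢
  linear_combination h

include hr in
theorem map_gammaD_sub : π (⟨gammaD D, gammaD_mem⟩ - (r : quadOrder D)) = 0 := by
  rw [map_sub, map_intCast, ← extendZero_of_mem, hr, sub_self]

theorem mem_quadOrder_of_intCast_mul {n : ℤ} (hn : n ≠ 0) (hD : IsDiscriminant D)
    {x : QuadField D} {u v : ℤ} (hu : n ∣ u) (hv : n ∣ v)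
    (h : (n : QuadField D) * x = u + v * gammaD D) : x ∈ quadOrder D := by
  obtain ⟨u, rfl⟩ := hu
  obtain ⟨v, rfl⟩ := hv
  refine (mem_quadOrder_iff hD).2 ⟨u, v, ?_⟩
  refine sub_eq_zero.1 (intCast_ne_zero hn ?_)
  push_cast at h
  linear_combination h

end Residues

/-! ### Inverse ideals, and the failure of invertibility -/

section InverseIdeals

variable {D : ℕ} {𝔞 𝔟 : Ideal (quadOrder D)}

theorem idealInverse_anti (h : 𝔞 ≤ 𝔟) : idealInverse 𝔟 ⊆ idealInverse 𝔞 :=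
  fun _ hx y hy => hx y (h hy)

theorem mem_idealInverse_of_mem {x : QuadField D} (hx : x ∈ quadOrder D) : x ∈ idealInverse 𝔞 :=
  fun y _ => mul_mem hx y.2

theorem mul_mem_idealInverse {x y : QuadField D} (hx : x ∈ quadOrder D)
    (hy : y ∈ idealInverse 𝔞) : x * y ∈ idealInverse 𝔞 := fun z hz => by
  rw [mul_assoc]
  exact mul_mem hx (hy z hz)

variable {p : ℕ} (π : quadOrder D →+* ZMod p)

/-- Multiplication by an element of `𝔞 ∩ ker π` and by one of `𝔞⁻¹` lands in `ker π`, if `𝔞` and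
`ker π` are coprime. -/
theorem extendZero_mul_eq_zero {e : quadOrder D} (he : e ∈ 𝔞) (hπe : π e = 1)
    {y : quadOrder D} (hy : y ∈ 𝔞) (hπy : π y = 0) {x : QuadField D} (hx : x ∈ idealInverse 𝔞) :
    extendZero π (x * y) = 0 := by
  have h1 : extendZero π (x * e * y) = 0 := by
    rw [extendZero_mul π (hx e he) y.2, extendZero_coe, hπy, mul_zero]
  have h2 : extendZero π (e * (x * y)) = extendZero π (x * y) := by
    rw [extendZero_mul π e.2 (hx y hy), extendZero_coe, hπe, one_mul]
  rw [← h2, ← h1]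
  congr 1
  ring

variable [Fact p.Prime] (hD : IsDiscriminant D) {r : ℤ} (hr : extendZero π (gammaD D) = r)
  {e : quadOrder D} (he : e ∈ 𝔞) (hπe : π e = 1)

theorem sub_one_mul_mem {e : quadOrder D} (hπe : π e = 1) {y : quadOrder D} (hy : y ∈ 𝔞) :
    (1 - e) * y ∈ 𝔞 ⊓ RingHom.ker π :=
  ⟨𝔞.mul_mem_left _ hy, by simp [RingHom.mem_ker, hπe]⟩

include hD hr he in
-- Multiplying by e ∈ 𝔞 moves η into 𝔭⁻¹. Testing against p shows that peη is integral; testing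
-- against γ_D - r gives the congruence, since u + (D - r)v is the γ_D-coefficient of (γ_D - r)(u +
-- vγ_D).
theorem exists_coordinates_of_mem_idealInverse {η : QuadField D}
    (hη : η ∈ idealInverse (𝔞 ⊓ RingHom.ker π)) :
    ∃ u v : ℤ, (p : QuadField D) * (e * η) = u + v * gammaD D ∧ (p : ℤ) ∣ u + (D - r) * v := by
  obtain ⟨N, hN⟩ := exists_normForm hD
  have hγ := gammaD_mul_self N hN
  have h1 : e * (p : quadOrder D) ∈ 𝔞 ⊓ RingHom.ker π :=
    ⟨𝔞.mul_mem_right _ he, by simp [RingHom.mem_ker]⟩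
  have h2 : e * (⟨gammaD D, gammaD_mem⟩ - (r : quadOrder D)) ∈ 𝔞 ⊓ RingHom.ker π := by
    refine ⟨𝔞.mul_mem_right _ he, ?_⟩
    rw [SetLike.mem_coe, RingHom.mem_ker, map_mul, map_gammaD_sub π hr, mul_zero]
  obtain ⟨u, v, huv⟩ := (mem_quadOrder_iff hD).1 (hη _ h1)
  obtain ⟨u', v', huv'⟩ := (mem_quadOrder_iff hD).1 (hη _ h2)
  push_cast at huv huv'
  refine ⟨u, v, by rw [← huv]; ring, ⟨v', ?_⟩⟩
  have h3 : ((-r * u - v * N : ℤ) : QuadField D) + (u + (D - r) * v : ℤ) * gammaD D =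
      (p * u' : ℤ) + (p * v' : ℤ) * gammaD D := by
    push_cast
    linear_combination (p : QuadField D) * huv' - (gammaD D - r) * huv - v * hγ
  exact (intCast_add_mul_gammaD_inj h3).2

/-- The element `(γ_D + r - D) / p`, which generates `𝔭⁻¹` over `𝓞_D` for the prime ideal
`𝔭 = (p, γ_D - r)`. -/
def inverseGenerator (D p : ℕ) (r : ℤ) : QuadField D :=
  ⟨((r : ℚ) - D / 2) / p, 1 / 2 / p⟩

theorem mul_inverseGenerator :
    (p : QuadField D) * inverseGenerator D p r = gammaD D - ((D - r : ℤ) : QuadField D) := by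
  have : (p : ℚ) ≠ 0 := by exact_mod_cast (Fact.out : p.Prime).ne_zero
  ext
  · simp [inverseGenerator, gammaD]
    field_simp
    ring
  · simp [inverseGenerator, gammaD]
    field_simp

include hD hr in
theorem inverseGenerator_mem :
    inverseGenerator D p r ∈ idealInverse (𝔞 ⊓ RingHom.ker π) := by
  rintro y ⟨-, hy⟩
  obtain ⟨N, hN⟩ := exists_normForm hD
  have hγ := gammaD_mul_self N hN
  obtain ⟨u, v, huv⟩ := (mem_quadOrder_iff hD).1 y.2
  rw [SetLike.mem_coe, RingHom.mem_ker, ← extendZero_coe, huv, extendZero_intCast_add π hr] at hy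
  have hy' : (p : ℤ) ∣ u + v * r := by
    rw [← ZMod.intCast_zmod_eq_zero_iff_dvd]
    exact_mod_cast hy
  have hp0 : (p : ℤ) ≠ 0 := by exact_mod_cast (Fact.out : p.Prime).ne_zero
  -- These are the coordinates of (γ_D - (D - r))(u + vγ_D).
  refine mem_quadOrder_of_intCast_mul hp0 hD (u := -(D - r) * u - v * N) (v := u + v * r) ?_ hy' ?_
  · have h1 := dvd_normForm π hr hN
    have : -(D - r) * u - v * N = -(D - r) * (u + v * r) - v * (r ^ 2 - D * r + N) := by ring
    rw [this]
    exact dvd_sub (Dvd.dvd.mul_left hy' _) (Dvd.dvd.mul_left h1 _)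
  · have h1 := mul_inverseGenerator (D := D) (p := p) (r := r)
    rw [huv]
    push_cast at h1 ⊢
    linear_combination (u + v * gammaD D) * h1 + v * hγ

include hD hr he hπe in
/-- The quotient `(𝔞 ∩ 𝔭)⁻¹ / 𝔞⁻¹` is a one-dimensional vector space over `𝓞_D / 𝔭 = 𝔽_p`, for a
prime ideal `𝔭` that is coprime to `𝔞`. -/
theorem exists_residueMap : ∃ κ : QuadField D → ZMod p,
    (∀ x ∈ idealInverse (𝔞 ⊓ RingHom.ker π), ∀ y ∈ idealInverse (𝔞 ⊓ RingHom.ker π),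
      κ (x - y) = κ x - κ y) ∧
    (∀ a : quadOrder D, ∀ x ∈ idealInverse (𝔞 ⊓ RingHom.ker π), κ ((a : QuadField D) * x) = π a * κ x) ∧
    (∀ x ∈ idealInverse (𝔞 ⊓ RingHom.ker π), κ x = 0 ↔ x ∈ idealInverse 𝔞) ∧
    ∃ c ∈ idealInverse (𝔞 ⊓ RingHom.ker π), κ c = 1 := by
  obtain ⟨N, hN⟩ := exists_normForm hD
  have hγ := gammaD_mul_self N hN
  have hp0 : (p : ℤ) ≠ 0 := by exact_mod_cast (Fact.out : p.Prime).ne_zero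
  -- Modulo p the other coordinate of peη is -(D - r)v, so the γ_D-coefficient v alone determines
  -- the class.
  refine ⟨fun η => (gammaCoeff ((p : QuadField D) * ((e : QuadField D) * η)) : ZMod p), ?_, ?_, ?_, ?_⟩
  · intro x hx y hy
    obtain ⟨u, v, h1, -⟩ := exists_coordinates_of_mem_idealInverse π hD hr he hx
    obtain ⟨u', v', h2, -⟩ := exists_coordinates_of_mem_idealInverse π hD hr he hy
    have h3 : (p : QuadField D) * (e * (x - y)) = ((u - u' : ℤ) : QuadField D) +
        ((v - v' : ℤ) : QuadField D) * gammaD D := by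
      push_cast
      linear_combination h1 - h2
    simp only [h1, h2, h3, gammaCoeff_intCast_add]
    push_cast
    ring
  · intro a x hx
    obtain ⟨u, v, h1, h2⟩ := exists_coordinates_of_mem_idealInverse π hD hr he hx
    obtain ⟨s, t, hst⟩ := (mem_quadOrder_iff hD).1 a.2
    have h3 : (p : QuadField D) * (e * (a * x)) = ((s * u - t * v * N : ℤ) : QuadField D) +
        ((s * v + t * u + t * v * D : ℤ) : QuadField D) * gammaD D := by
      push_cast
      rw [hst]
      linear_combination (s + t * gammaD D) * h1 + t * v * hγ
    simp only [h1, h3, gammaCoeff_intCast_add]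
    rw [← extendZero_coe, hst, extendZero_intCast_add π hr]
    rw [← ZMod.intCast_zmod_eq_zero_iff_dvd] at h2
    push_cast at h2 ⊢
    linear_combination (t : ZMod p) * h2
  · intro x hx
    constructor
    · intro h0
      obtain ⟨u, v, h1, h2⟩ := exists_coordinates_of_mem_idealInverse π hD hr he hx
      simp only [h1, gammaCoeff_intCast_add, ZMod.intCast_zmod_eq_zero_iff_dvd] at h0
      have hu : (p : ℤ) ∣ u := (dvd_add_left (Dvd.dvd.mul_left h0 _)).1 h2
      have hex : (e : QuadField D) * x ∈ quadOrder D :=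
        mem_quadOrder_of_intCast_mul hp0 hD hu h0 (by exact_mod_cast h1)
      intro y hy
      -- Split xy = x(1 - e)y + (ex)y, where (1 - e)y lies in 𝔞 ∩ 𝔭 and ex is integral.
      have h3 := hx _ (sub_one_mul_mem π hπe hy)
      have h4 := mul_mem hex y.2
      convert add_mem h3 h4 using 1
      push_cast
      ring
    · intro hx'
      obtain ⟨u, v, huv⟩ := (mem_quadOrder_iff hD).1 (hx' e he)
      have h3 : (p : QuadField D) * (e * x) = ((p * u : ℤ) : QuadField D) +
          ((p * v : ℤ) : QuadField D) * gammaD D := by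
        push_cast
        linear_combination (p : QuadField D) * huv
      simp only [h3, gammaCoeff_intCast_add]
      simp
  · refine ⟨_, inverseGenerator_mem π hD hr, ?_⟩
    obtain ⟨s, t, hst⟩ := (mem_quadOrder_iff hD).1 e.2
    have h1 := mul_inverseGenerator (D := D) (p := p) (r := r)
    have h3 : (p : QuadField D) * (e * inverseGenerator D p r) =
        ((-(D - r) * s - t * N : ℤ) : QuadField D) +
        ((s + t * r : ℤ) : QuadField D) * gammaD D := by
      rw [hst]
      push_cast at h1 ⊢
      linear_combination (s + t * gammaD D) * h1 + t * hγ
    rw [← extendZero_coe, hst, extendZero_intCast_add π hr] at hπe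
    simp only [h3, gammaCoeff_intCast_add]
    exact_mod_cast hπe

include hD hr he hπe in
-- Take x = (γ_D + r - D)/p. Its products with p and with γ_D - r are γ_D + r - D, of residue 2r -
-- D, and -(r² - Dr + N)/p. By hypothesis one of these residues is nonzero, so (𝔞 ∩ 𝔭)(𝔞 ∩ 𝔭)⁻¹ is
-- not inside 𝔭.
theorem exists_extendZero_mul_ne_zero {N : ℤ} (hN : 4 * N = (D : ℤ) ^ 2 - D)
    (h : ¬ ((p : ℤ) ∣ 2 * r - D ∧ (p : ℤ) ^ 2 ∣ r ^ 2 - D * r + N)) :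
    ∃ y ∈ 𝔞 ⊓ RingHom.ker π, ∃ x ∈ idealInverse (𝔞 ⊓ RingHom.ker π),
      extendZero π (x * (y : QuadField D)) ≠ 0 := by
  have hγ := gammaD_mul_self N hN
  have hp0 : (p : ℤ) ≠ 0 := by exact_mod_cast (Fact.out : p.Prime).ne_zero
  have h1 := mul_inverseGenerator (D := D) (p := p) (r := r)
  by_cases h2 : (p : ℤ) ∣ 2 * r - D
  · have h3 : ¬ (p : ℤ) ^ 2 ∣ r ^ 2 - D * r + N := fun h3 => h ⟨h2, h3⟩
    obtain ⟨t, ht⟩ := dvd_normForm π hr hN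
    rw [ht, pow_two, mul_dvd_mul_iff_left hp0] at h3
    have hg : ((⟨gammaD D, gammaD_mem⟩ : quadOrder D) - (r : quadOrder D)) ∈ RingHom.ker π :=
      map_gammaD_sub π hr
    refine ⟨e * (⟨gammaD D, gammaD_mem⟩ - (r : quadOrder D)),
      ⟨𝔞.mul_mem_right _ he, Ideal.mul_mem_left _ _ hg⟩, _, inverseGenerator_mem π hD hr, ?_⟩
    have h4 : inverseGenerator D p r * ((e * (⟨gammaD D, gammaD_mem⟩ - (r : quadOrder D)) :
        quadOrder D) : QuadField D) = e * ((-t : ℤ) : QuadField D) := by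
      refine sub_eq_zero.1 (intCast_ne_zero hp0 ?_)
      have ht' : (r : QuadField D) ^ 2 - D * r + N = p * t := by exact_mod_cast congrArg (Int.cast : ℤ → QuadField D) ht
      push_cast at h1 ⊢
      linear_combination (e : QuadField D) * (gammaD D - r) * h1 + (e : QuadField D) * hγ
        - (e : QuadField D) * ht'
    rw [h4, extendZero_mul π e.2 (intCast_mem _ _), extendZero_coe, hπe, one_mul,
      extendZero_intCast, Ne, ZMod.intCast_zmod_eq_zero_iff_dvd, dvd_neg]
    exact h3
  · refine ⟨e * (p : quadOrder D), ⟨𝔞.mul_mem_right _ he, by simp [RingHom.mem_ker]⟩, _,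
      inverseGenerator_mem π hD hr, ?_⟩
    have h4 : inverseGenerator D p r * ((e * (p : quadOrder D) : quadOrder D) : QuadField D) =
        e * (((r - D : ℤ) : QuadField D) + ((1 : ℤ) : QuadField D) * gammaD D) := by
      push_cast at h1 ⊢
      linear_combination (e : QuadField D) * h1
    rw [h4, extendZero_mul π e.2 ((mem_quadOrder_iff hD).2 ⟨_, _, rfl⟩), extendZero_coe, hπe,
      one_mul, extendZero_intCast_add π hr]
    rw [← ZMod.intCast_zmod_eq_zero_iff_dvd] at h2
    convert h2 using 1
    push_cast
    ring

include hD hr he hπe in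
-- The non-invertible case. With y = pk + t(γ_D - r) and pex = u + vγ_D, the product exy has residue
-- k(u + vr): the t-part drops out as p² divides r² - Dr + N. Finally u + vr ≡ u + (D - r)v ≡ 0,
-- because r ≡ D - r modulo p.
theorem extendZero_mul_eq_zero_of_dvd {N : ℤ} (hN : 4 * N = (D : ℤ) ^ 2 - D)
    (h1 : (p : ℤ) ∣ 2 * r - D) (h2 : (p : ℤ) ^ 2 ∣ r ^ 2 - D * r + N) {y : quadOrder D}
    (hy : y ∈ 𝔞 ⊓ RingHom.ker π) {x : QuadField D}
    (hx : x ∈ idealInverse (𝔞 ⊓ RingHom.ker π)) : extendZero π (x * (y : QuadField D)) = 0 := by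
  have hγ := gammaD_mul_self N hN
  have hp0 : (p : ℤ) ≠ 0 := by exact_mod_cast (Fact.out : p.Prime).ne_zero
  have hy0 := hy.2
  obtain ⟨s, t, hst⟩ := (mem_quadOrder_iff hD).1 y.2
  rw [SetLike.mem_coe, RingHom.mem_ker, ← extendZero_coe, hst, extendZero_intCast_add π hr] at hy0
  obtain ⟨k, hk⟩ : (p : ℤ) ∣ s + t * r := by
    rw [← ZMod.intCast_zmod_eq_zero_iff_dvd]
    exact_mod_cast hy0
  obtain ⟨u, v, huv, l, hl⟩ := exists_coordinates_of_mem_idealInverse π hD hr he hx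
  obtain ⟨m, hm⟩ := h2
  obtain ⟨n, hn⟩ := h1
  have h3 : (e : QuadField D) * (x * y) =
      ((k * u - t * l * r - t * v * (p * m) : ℤ) : QuadField D) +
      ((k * v + t * l : ℤ) : QuadField D) * gammaD D := by
    refine sub_eq_zero.1 (intCast_ne_zero hp0 ?_)
    have hk' : (s : QuadField D) + t * r = p * k := by exact_mod_cast congrArg (Int.cast : ℤ → QuadField D) hk
    have hl' : (u : QuadField D) + (D - r) * v = p * l := by exact_mod_cast congrArg (Int.cast : ℤ → QuadField D) hl
    have hm' : (r : QuadField D) ^ 2 - D * r + N = p ^ 2 * m := by exact_mod_cast congrArg (Int.cast : ℤ → QuadField D) hm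
    rw [hst]
    push_cast
    linear_combination (s + t * gammaD D) * huv + (u + v * gammaD D) * hk' + t * v * hγ
      + t * (gammaD D - r) * hl' - t * v * hm'
  have h4 : extendZero π (e * (x * y)) = extendZero π (x * y) := by
    rw [extendZero_mul π e.2 (hx y hy), extendZero_coe, hπe, one_mul]
  rw [← h4, h3, extendZero_intCast_add π hr]
  have hl' : (u : ZMod p) + (D - r) * v = 0 := by
    have := congrArg (Int.cast : ℤ → ZMod p) hl
    push_cast at this
    simpa using this
  have hn' : (2 : ZMod p) * r - D = 0 := by
    have := congrArg (Int.cast : ℤ → ZMod p) hn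
    push_cast at this
    simpa using this
  push_cast
  rw [CharP.cast_eq_zero]
  linear_combination (k : ZMod p) * hl' + k * v * hn'

end InverseIdeals

/-! ### Indices of the intersection in the two modular groups -/

section ModularGroups

variable {D : ℕ} {𝔞 : Ideal (quadOrder D)}

/-- The upper triangular unipotent matrix with upper right entry `√D y`. -/
def upperUnipotent (y : QuadField D) : SL(2, QuadField D) :=
  ⟨!![1, sqrtD D * y; 0, 1], by simp⟩

/-- The lower triangular unipotent matrix with lower left entry `x / √D`. -/
def lowerUnipotent (x : QuadField D) : SL(2, QuadField D) :=
  ⟨!![1, 0; sqrtDInv D * x, 1], by simp⟩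

theorem upperUnipotent_mem {y : quadOrder D} (hy : y ∈ 𝔞) :
    upperUnipotent (y : QuadField D) ∈ hilbertModularGroup 𝔞 :=
  ⟨by simp [upperUnipotent], by simp [upperUnipotent], ⟨y, hy, by simp [upperUnipotent]⟩,
    fun z _ => by simp [upperUnipotent]⟩

theorem lowerUnipotent_mem (hD : IsDiscriminant D) {x : QuadField D} (hx : x ∈ idealInverse 𝔞) :
    lowerUnipotent x ∈ hilbertModularGroup 𝔞 := by
  refine ⟨by simp [lowerUnipotent], by simp [lowerUnipotent],
    ⟨0, 𝔞.zero_mem, by simp [lowerUnipotent]⟩, ?_⟩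
  have : sqrtD D * lowerUnipotent x 1 0 = x := by
    simp [lowerUnipotent, ← mul_assoc, sqrtD_mul_sqrtDInv hD]
  rwa [this]

theorem sqrtDInv_mul_sqrtD_mul (hD : IsDiscriminant D) (x : QuadField D) :
    sqrtDInv D * (sqrtD D * x) = x := by
  linear_combination x * sqrtD_mul_sqrtDInv hD

theorem sqrtDInv_mul_mem (hD : IsDiscriminant D) {g : SL(2, QuadField D)}
    (hg : g ∈ hilbertModularGroup 𝔞) :
    ∃ y ∈ 𝔞, (y : QuadField D) = sqrtDInv D * g 0 1 := by
  obtain ⟨-, -, ⟨y, hy, hyg⟩, -⟩ := hg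
  exact ⟨y, hy, by rw [hyg, sqrtDInv_mul_sqrtD_mul hD]⟩

theorem det_eq_one (g : SL(2, QuadField D)) : g 0 0 * g 1 1 - g 0 1 * g 1 0 = 1 := by
  rw [← Matrix.det_fin_two]
  exact g.2

/-- The factor √D is shifted from the upper right to the lower left entry, so that every term of the
determinant is integral and can be reduced modulo 𝔭. -/
theorem one_eq_sub_of_mem (hD : IsDiscriminant D) {g : SL(2, QuadField D)} {y : quadOrder D}
    (hyg : (y : QuadField D) = sqrtDInv D * g 0 1) :
    (1 : QuadField D) = g 0 0 * g 1 1 - sqrtD D * g 1 0 * y := by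
  rw [hyg]
  linear_combination g 0 1 * g 1 0 * sqrtD_mul_sqrtDInv hD - det_eq_one g

theorem unipotent_mul_apply (hD : IsDiscriminant D) (x y : QuadField D) :
    (upperUnipotent y * lowerUnipotent x) 0 0 = 1 + y * x ∧
      (lowerUnipotent x * upperUnipotent y) 1 1 = 1 + x * y := by
  constructor <;> rw [Matrix.SpecialLinearGroup.coe_mul, Matrix.mul_apply, Fin.sum_univ_two] <;>
    simp [upperUnipotent, lowerUnipotent] <;>
    linear_combination x * y * sqrtD_mul_sqrtDInv hD

theorem mul_inv_apply (g h : SL(2, QuadField D)) :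
    (g * h⁻¹) 0 1 = g 0 1 * h 0 0 - g 0 0 * h 0 1 ∧
      (g * h⁻¹) 1 0 = g 1 0 * h 1 1 - g 1 1 * h 1 0 := by
  constructor <;>
  · rw [Matrix.SpecialLinearGroup.coe_mul, Matrix.mul_apply, Fin.sum_univ_two,
      Matrix.SpecialLinearGroup.SL2_inv_expl]
    simp
    ring

variable {p : ℕ} [Fact p.Prime] (hD : IsDiscriminant D) (π : quadOrder D →+* ZMod p)
  {e : quadOrder D} (he : e ∈ 𝔞) (hπe : π e = 1)

include hD in
-- Since 𝔞⁻¹ ⊆ (𝔞 ∩ 𝔭)⁻¹, only the upper right entry is constrained.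
theorem mem_hilbertModularGroup_inf_iff {g : SL(2, QuadField D)}
    (hg : g ∈ hilbertModularGroup 𝔞) :
    g ∈ hilbertModularGroup 𝔞 ⊓ hilbertModularGroup (𝔞 ⊓ RingHom.ker π) ↔
      extendZero π (sqrtDInv D * g 0 1) = 0 := by
  constructor
  · rintro ⟨-, hg'⟩
    obtain ⟨y, hy, hyg⟩ := sqrtDInv_mul_mem hD hg'
    rw [← hyg, extendZero_coe]
    exact hy.2
  · intro h
    obtain ⟨h1, h2, ⟨y, hy, hyg⟩, h4⟩ := hg
    refine ⟨⟨h1, h2, ⟨y, hy, hyg⟩, h4⟩, h1, h2, ⟨y, ⟨hy, ?_⟩, hyg⟩,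
      idealInverse_anti inf_le_left h4⟩
    rwa [hyg, sqrtDInv_mul_sqrtD_mul hD, extendZero_coe] at h

include hD he hπe in
-- The invariant is the top row modulo 𝔭, with the upper right entry divided by √D. Both residues
-- cannot vanish: by coprimality the determinant would then be 0 modulo 𝔭.
theorem hasCosetReps_inf_left : HasCosetReps
    (hilbertModularGroup 𝔞 ⊓ hilbertModularGroup (𝔞 ⊓ RingHom.ker π))
    (hilbertModularGroup 𝔞) (p + 1) := by
  have hβ : ∀ g ∈ hilbertModularGroup 𝔞, sqrtDInv D * g 0 1 ∈ quadOrder D := fun g hg => by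
    obtain ⟨y, -, hy⟩ := sqrtDInv_mul_mem hD hg
    exact hy ▸ y.2
  refine HasCosetReps.of_projectiveLine (fun g => extendZero π (g 0 0))
    (fun g => extendZero π (sqrtDInv D * g 0 1)) ?_ ?_
    (fun j => upperUnipotent ((j.val : quadOrder D) * e : quadOrder D)) ?_ ?_ ?_
    -- Its upper left entry 1 - e has residue 0, which reaches the point [0 : 1].
    (upperUnipotent (e : QuadField D) * lowerUnipotent (-1)) ?_ ?_
  · intro g hg h hh
    rw [mem_hilbertModularGroup_inf_iff hD π (mul_mem hg (inv_mem hh)), (mul_inv_apply g h).1,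
      show sqrtDInv D * (g 0 1 * h 0 0 - g 0 0 * h 0 1) =
        h 0 0 * (sqrtDInv D * g 0 1) - g 0 0 * (sqrtDInv D * h 0 1) by ring,
      extendZero_sub π (mul_mem hh.1 (hβ g hg)) (mul_mem hg.1 (hβ h hh)),
      extendZero_mul π hh.1 (hβ g hg), extendZero_mul π hg.1 (hβ h hh), sub_eq_zero]
    exact eq_comm
  · intro g hg h1 h2
    obtain ⟨y, hy, hyg⟩ := sqrtDInv_mul_mem hD hg
    have h3 : extendZero π (sqrtD D * g 1 0 * y) = 0 := by
      refine extendZero_mul_eq_zero π he hπe hy ?_ hg.2.2.2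
      rwa [← hyg, extendZero_coe] at h2
    have h4 := one_eq_sub_of_mem hD hyg
    have h5 := congrArg (extendZero π) h4
    rw [extendZero_sub π (mul_mem hg.1 hg.2.1) (hg.2.2.2 y hy), extendZero_mul π hg.1 hg.2.1, h1,
      h3, extendZero_one] at h5
    simp at h5
  · exact fun j => upperUnipotent_mem (𝔞.mul_mem_left _ he)
  · intro j
    simp [upperUnipotent]
  · intro j
    simp only [upperUnipotent, Matrix.of_apply, Matrix.cons_val', Matrix.cons_val_zero,
      Matrix.cons_val_one, Matrix.cons_val_fin_one]
    rw [sqrtDInv_mul_sqrtD_mul hD, extendZero_coe, map_mul, hπe, map_natCast, mul_one,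
      ZMod.natCast_zmod_val]
  · exact mul_mem (upperUnipotent_mem he)
      (lowerUnipotent_mem hD (mem_idealInverse_of_mem (neg_mem (one_mem _))))
  · have h1 : (upperUnipotent (e : QuadField D) * lowerUnipotent (-1) : SL(2, QuadField D)) 0 0 =
        1 - (e : QuadField D) := by
      rw [(unipotent_mul_apply hD _ _).1]
      ring
    simp only [h1]
    rw [extendZero_sub π (one_mem _) e.2, extendZero_one, extendZero_coe, hπe, sub_self]

variable {r : ℤ} (hr : extendZero π (gammaD D) = r)

theorem hasCosetReps_inf_right_aux (κ : QuadField D → ZMod p)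
    (hκ : (∀ x ∈ idealInverse (𝔞 ⊓ RingHom.ker π), ∀ y ∈ idealInverse (𝔞 ⊓ RingHom.ker π),
      κ (x - y) = κ x - κ y) ∧
    (∀ a : quadOrder D, ∀ x ∈ idealInverse (𝔞 ⊓ RingHom.ker π), κ (a * x) = π a * κ x) ∧
    (∀ x ∈ idealInverse (𝔞 ⊓ RingHom.ker π), κ x = 0 ↔ x ∈ idealInverse 𝔞))
    (g : SL(2, QuadField D)) (hg : g ∈ hilbertModularGroup (𝔞 ⊓ RingHom.ker π))
    (h : SL(2, QuadField D)) (hh : h ∈ hilbertModularGroup (𝔞 ⊓ RingHom.ker π)) :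
    g * h⁻¹ ∈ hilbertModularGroup 𝔞 ⊓ hilbertModularGroup (𝔞 ⊓ RingHom.ker π) ↔
      extendZero π (g 1 1) * κ (sqrtD D * h 1 0) = extendZero π (h 1 1) * κ (sqrtD D * g 1 0) := by
  obtain ⟨hκ1, hκ2, hκ3⟩ := hκ
  have key : ∀ g ∈ hilbertModularGroup (𝔞 ⊓ RingHom.ker π),
      g ∈ hilbertModularGroup 𝔞 ⊓ hilbertModularGroup (𝔞 ⊓ RingHom.ker π) ↔
        κ (sqrtD D * g 1 0) = 0 := by
    intro g hg
    rw [hκ3 _ hg.2.2.2]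
    refine ⟨fun h => h.1.2.2.2, fun h => ⟨?_, hg⟩⟩
    obtain ⟨h1, h2, ⟨y, hy, hyg⟩, -⟩ := hg
    exact ⟨h1, h2, ⟨y, hy.1, hyg⟩, h⟩
  rw [key _ (mul_mem hg (inv_mem hh)), (mul_inv_apply g h).2,
    show sqrtD D * (g 1 0 * h 1 1 - g 1 1 * h 1 0) =
      h 1 1 * (sqrtD D * g 1 0) - g 1 1 * (sqrtD D * h 1 0) by ring,
    hκ1 _ (mul_mem_idealInverse hh.2.1 hg.2.2.2) _ (mul_mem_idealInverse hg.2.1 hh.2.2.2),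
    extendZero_of_mem π hg.2.1, extendZero_of_mem π hh.2.1,
    ← hκ2 ⟨_, hg.2.1⟩ _ hh.2.2.2, ← hκ2 ⟨_, hh.2.1⟩ _ hg.2.2.2, sub_eq_zero]
  exact eq_comm

include hD hr he hπe in
-- The off-diagonal term of the determinant vanishes modulo 𝔭, so the lower right entry is a unit
-- there and the bottom row only sees the affine line.
theorem hasCosetReps_inf_right_of_dvd {N : ℤ} (hN : 4 * N = (D : ℤ) ^ 2 - D)
    (h1 : (p : ℤ) ∣ 2 * r - D) (h2 : (p : ℤ) ^ 2 ∣ r ^ 2 - D * r + N) : HasCosetReps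
    (hilbertModularGroup 𝔞 ⊓ hilbertModularGroup (𝔞 ⊓ RingHom.ker π))
    (hilbertModularGroup (𝔞 ⊓ RingHom.ker π)) p := by
  obtain ⟨κ, hκ1, hκ2, hκ3, c, hc, hκc⟩ := exists_residueMap π hD hr he hπe
  refine HasCosetReps.of_affineLine (fun g => extendZero π (g 1 1))
    (fun g => κ (sqrtD D * g 1 0)) (hasCosetReps_inf_right_aux π κ ⟨hκ1, hκ2, hκ3⟩) ?_
    (fun j => lowerUnipotent (((j.val : quadOrder D) : QuadField D) * c)) ?_ ?_ ?_
  · intro g hg h3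
    obtain ⟨y, hy, hyg⟩ := sqrtDInv_mul_mem hD hg
    have h5 := congrArg (extendZero π) (one_eq_sub_of_mem hD hyg)
    rw [extendZero_sub π (mul_mem hg.1 hg.2.1) (hg.2.2.2 y hy), extendZero_mul π hg.1 hg.2.1, h3,
      extendZero_mul_eq_zero_of_dvd π hD hr he hπe hN h1 h2 hy hg.2.2.2, extendZero_one] at h5
    simp at h5
  · exact fun j => lowerUnipotent_mem hD (mul_mem_idealInverse (Subtype.prop _) hc)
  · intro j
    simp [lowerUnipotent]
  · intro j
    have : sqrtD D * lowerUnipotent (((j.val : quadOrder D) : QuadField D) * c) 1 0 =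
        ((j.val : quadOrder D) : QuadField D) * c := by
      simp [lowerUnipotent, ← mul_assoc, sqrtD_mul_sqrtDInv hD]
    simp only [this]
    rw [hκ2 _ c hc, hκc, map_natCast, mul_one, ZMod.natCast_zmod_val]

include hD hr he hπe in
theorem hasCosetReps_inf_right_of_not_dvd {N : ℤ} (hN : 4 * N = (D : ℤ) ^ 2 - D)
    (h : ¬ ((p : ℤ) ∣ 2 * r - D ∧ (p : ℤ) ^ 2 ∣ r ^ 2 - D * r + N)) : HasCosetReps
    (hilbertModularGroup 𝔞 ⊓ hilbertModularGroup (𝔞 ⊓ RingHom.ker π))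
    (hilbertModularGroup (𝔞 ⊓ RingHom.ker π)) (p + 1) := by
  obtain ⟨κ, hκ1, hκ2, hκ3, c, hc, hκc⟩ := exists_residueMap π hD hr he hπe
  obtain ⟨y, hy, x, hx, hxy⟩ := exists_extendZero_mul_ne_zero π hD hr he hπe hN h
  -- Chosen so that 1 + txy, the lower right entry of the extra representative, has residue 0.
  set t : ZMod p := -(extendZero π (x * (y : QuadField D)))⁻¹ with ht
  have hxt : ((t.val : quadOrder D) : QuadField D) * x ∈ idealInverse (𝔞 ⊓ RingHom.ker π) :=
    mul_mem_idealInverse (Subtype.prop _) hx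
  refine HasCosetReps.of_projectiveLine (fun g => extendZero π (g 1 1))
    (fun g => κ (sqrtD D * g 1 0)) (hasCosetReps_inf_right_aux π κ ⟨hκ1, hκ2, hκ3⟩) ?_
    (fun j => lowerUnipotent (((j.val : quadOrder D) : QuadField D) * c)) ?_ ?_ ?_
    (lowerUnipotent (((t.val : quadOrder D) : QuadField D) * x) * upperUnipotent (y : QuadField D))
    ?_ ?_
  · intro g hg h3 h4
    obtain ⟨z, hz, hzg⟩ := sqrtDInv_mul_mem hD hg
    have h5 := congrArg (extendZero π) (one_eq_sub_of_mem hD hzg)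
    rw [extendZero_sub π (mul_mem hg.1 hg.2.1) (hg.2.2.2 z hz), extendZero_mul π hg.1 hg.2.1, h3,
      extendZero_mul_eq_zero π he hπe hz.1 hz.2 ((hκ3 _ hg.2.2.2).1 h4), extendZero_one] at h5
    simp at h5
  · exact fun j => lowerUnipotent_mem hD (mul_mem_idealInverse (Subtype.prop _) hc)
  · intro j
    simp [lowerUnipotent]
  · intro j
    have : sqrtD D * lowerUnipotent (((j.val : quadOrder D) : QuadField D) * c) 1 0 =
        ((j.val : quadOrder D) : QuadField D) * c := by
      simp [lowerUnipotent, ← mul_assoc, sqrtD_mul_sqrtDInv hD]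
    simp only [this]
    rw [hκ2 _ c hc, hκc, map_natCast, mul_one, ZMod.natCast_zmod_val]
  · exact mul_mem (lowerUnipotent_mem hD hxt) (upperUnipotent_mem hy)
  · have h1 := (unipotent_mul_apply hD (((t.val : quadOrder D) : QuadField D) * x) y).2
    rw [mul_assoc] at h1
    simp only [h1]
    rw [extendZero_add π (one_mem _) (mul_mem (Subtype.prop _) (hx y hy)), extendZero_one,
      extendZero_mul π (Subtype.prop _) (hx y hy), extendZero_coe, map_natCast,
      ZMod.natCast_zmod_val, ht, neg_mul, inv_mul_cancel₀ hxy, add_neg_cancel]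

end ModularGroups

/-! ### The local criterion for p to divide the conductor -/

section Conductor

variable {D f : ℕ} {N r : ℤ}

theorem not_nine_dvd_of_isFundamentalDiscriminant {D₀ : ℕ} (h : IsFundamentalDiscriminant D₀) :
    ¬ 9 ∣ D₀ := by
  have key : ∀ m : ℕ, Squarefree m → ¬ 9 ∣ m := fun m hm h9 => by
    have := hm 3 h9
    simp at this
  rcases h with ⟨-, h⟩ | ⟨m, rfl, -, h⟩
  · exact key _ h
  · intro h9
    exact key m h ((Nat.Coprime.dvd_mul_left (by norm_num)).1 h9)

/-- From 4(r² - Dr + N) = (2r - D)² - D, the condition amounts to 9 ∣ D, and a fundamental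
discriminant is not divisible by 9. -/
theorem three_dvd_conductor_iff (hf : IsConductor D f) (hN : 4 * N = (D : ℤ) ^ 2 - D)
    (hr : (3 : ℤ) ∣ r ^ 2 - D * r + N) :
    ((3 : ℤ) ∣ 2 * r - D ∧ (3 : ℤ) ^ 2 ∣ r ^ 2 - D * r + N) ↔ 3 ∣ f := by
  have h4 : 4 * (r ^ 2 - D * r + N) = (2 * r - D) ^ 2 - D := by linear_combination hN
  constructor
  · rintro ⟨h1, h2⟩
    have h3 : (3 : ℤ) ^ 2 ∣ D := by
      have : (D : ℤ) = (2 * r - D) ^ 2 - 4 * (r ^ 2 - D * r + N) := by rw [h4]; ring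
      rw [this]
      exact dvd_sub (pow_dvd_pow_of_dvd h1 2) (Dvd.dvd.mul_left h2 _)
    have h9 : 9 ∣ D := by
      have : ((9 : ℕ) : ℤ) ∣ (D : ℤ) := by simpa using h3
      exact_mod_cast this
    obtain ⟨D₀, h0, rfl⟩ := hf
    by_contra h5
    have hc : Nat.Coprime 9 (f ^ 2) := by
      have : Nat.Coprime 3 f := (Nat.Prime.coprime_iff_not_dvd Nat.prime_three).2 h5
      exact Nat.Coprime.pow 2 2 this
    exact not_nine_dvd_of_isFundamentalDiscriminant h0 (hc.dvd_of_dvd_mul_left h9)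
  · intro h
    have h9 : (3 : ℤ) ^ 2 ∣ D := by
      obtain ⟨D₀, h0, rfl⟩ := hf
      obtain ⟨g, rfl⟩ := h
      exact ⟨g ^ 2 * D₀, by push_cast; ring⟩
    have h5 : (3 : ℤ) ∣ 2 * r - D := by
      refine Int.Prime.dvd_pow' (k := 2) Nat.prime_three ?_
      have : (2 * r - D) ^ 2 = 4 * (r ^ 2 - D * r + N) + D := by rw [h4]; ring
      rw [this]
      exact dvd_add (Dvd.dvd.mul_left hr _) (dvd_trans (by norm_num) h9)
    refine ⟨h5, ?_⟩
    have h6 : (3 : ℤ) ^ 2 ∣ 4 * (r ^ 2 - D * r + N) := by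
      rw [h4]
      exact dvd_sub (pow_dvd_pow_of_dvd h5 2) h9
    exact IsCoprime.dvd_of_dvd_mul_left (by norm_num) h6

/-- The first divisibility makes D = 4m, and then r² - Dr + N ≡ r² - m modulo 4. Divisibility by 4
forces m ≡ 0, 1 modulo 4, so that D/4 is still a discriminant; conversely such an m is congruent to
r² modulo 4 as soon as it is modulo 2. -/
theorem two_dvd_conductor_iff (hf : IsConductor D f) (hN : 4 * N = (D : ℤ) ^ 2 - D)
    (hr : (2 : ℤ) ∣ r ^ 2 - D * r + N) :
    ((2 : ℤ) ∣ 2 * r - D ∧ (2 : ℤ) ^ 2 ∣ r ^ 2 - D * r + N) ↔ 2 ∣ f := by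
  have key : ∀ m : ℕ, D = 4 * m → r ^ 2 - D * r + N = r ^ 2 - m + 4 * (m ^ 2 - m * r) := by
    rintro m rfl
    push_cast at hN ⊢
    linarith
  have hr2 : (r % 4 = 0 ∨ r % 4 = 1 ∨ r % 4 = 2 ∨ r % 4 = 3) := by omega
  have hsq : (r ^ 2 % 4 = 0 ∧ r % 2 = 0) ∨ (r ^ 2 % 4 = 1 ∧ r % 2 = 1) := by
    rcases hr2 with h | h | h | h
    · left; exact ⟨by simp [pow_two, Int.mul_emod, h], by omega⟩
    · right; exact ⟨by simp [pow_two, Int.mul_emod, h], by omega⟩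
    · left; exact ⟨by simp [pow_two, Int.mul_emod, h], by omega⟩
    · right; exact ⟨by simp [pow_two, Int.mul_emod, h], by omega⟩
  obtain ⟨D₀, h0, hDf⟩ := hf
  constructor
  · rintro ⟨h1, h2⟩
    by_contra hodd
    have hf2 : f ^ 2 % 4 = 1 := by
      have : f % 4 = 1 ∨ f % 4 = 3 := by omega
      rcases this with h | h <;> simp [Nat.pow_mod, h]
    rcases h0 with ⟨h0, -⟩ | ⟨m, rfl, h0, -⟩
    · have : D % 4 = 1 := by
        rw [hDf, Nat.mul_mod, hf2, h0]
      omega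
    · have h3 := key (f ^ 2 * m) (by rw [hDf]; ring)
      have h5 : (f ^ 2 * m) % 4 = m % 4 := by rw [Nat.mul_mod, hf2]; simp
      rw [h3] at h2
      generalize f ^ 2 * m = n at *
      have h6 : (4 : ℤ) ∣ r ^ 2 - n := by
        norm_num at h2
        exact h2
      omega
  · rintro ⟨g, rfl⟩
    have h3 := key (g ^ 2 * D₀) (by rw [hDf]; ring)
    have hD₀ : D₀ % 4 = 0 ∨ D₀ % 4 = 1 := by
      rcases h0 with ⟨h0, -⟩ | ⟨m, rfl, h0, -⟩
      · exact Or.inr h0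
      · left; omega
    have hm : (g ^ 2 * D₀) % 4 = 0 ∨ (g ^ 2 * D₀) % 4 = 1 := by
      have : g % 4 = 0 ∨ g % 4 = 1 ∨ g % 4 = 2 ∨ g % 4 = 3 := by omega
      rcases this with h | h | h | h <;> rcases hD₀ with h' | h' <;>
        simp [Nat.pow_mod, Nat.mul_mod, h, h']
    have hD2 : D = 4 * (g ^ 2 * D₀) := by rw [hDf]; ring
    refine ⟨by omega, ?_⟩
    rw [h3] at hr ⊢
    generalize g ^ 2 * D₀ = n at *
    have h7 : (4 : ℤ) ∣ r ^ 2 - n := by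
      have : (2 : ℤ) ∣ r ^ 2 - n := by
        have := dvd_sub hr (Dvd.intro (2 * (((n : ℤ)) ^ 2 - n * r))
          (show (2 : ℤ) * _ = 4 * ((n : ℤ) ^ 2 - n * r) by ring))
        simpa using this
      omega
    exact dvd_add (by simpa using h7) (by norm_num)

end Conductor

/-! ### Ideals of norm 6 -/

section IdealOfNormSix

variable {D : ℕ}

/-- By Cauchy the quotient has additive elements of order 2 and 3, so its characteristic is 6 and it
is generated by 1. -/
theorem exists_ringHom_zmod_six {𝔟 : Ideal (quadOrder D)} (h : idealNorm 𝔟 = 6) :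
    ∃ ψ : quadOrder D →+* ZMod 6, RingHom.ker ψ = 𝔟 := by
  have hcard : Nat.card (quadOrder D ⧸ 𝔟) = 6 := h
  have hfin : Finite (quadOrder D ⧸ 𝔟) := Nat.finite_of_card_ne_zero (by rw [hcard]; norm_num)
  have := Fintype.ofFinite (quadOrder D ⧸ 𝔟)
  have hcard' : Fintype.card (quadOrder D ⧸ 𝔟) = 6 := by rw [← Nat.card_eq_fintype_card, hcard]
  have hdvd : ∀ q : ℕ, q.Prime → q ∣ 6 → q ∣ ringChar (quadOrder D ⧸ 𝔟) := by
    intro q hq hq6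
    have : Fact q.Prime := ⟨hq⟩
    obtain ⟨x, hx⟩ := exists_prime_addOrderOf_dvd_card (G := quadOrder D ⧸ 𝔟) q (hcard' ▸ hq6)
    rw [← hx]
    refine addOrderOf_dvd_of_nsmul_eq_zero ?_
    rw [nsmul_eq_mul, ringChar.Nat.cast_ringChar, zero_mul]
  have h6 : ringChar (quadOrder D ⧸ 𝔟) = 6 := by
    refine Nat.dvd_antisymm ?_ ?_
    · refine ringChar.dvd ?_
      rw [← hcard', Nat.cast_card_eq_zero]
    · exact Nat.Coprime.mul_dvd_of_dvd_of_dvd (by norm_num : Nat.Coprime 2 3)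
        (hdvd 2 Nat.prime_two (by norm_num)) (hdvd 3 Nat.prime_three (by norm_num))
  have hchar : CharP (quadOrder D ⧸ 𝔟) 6 := ringChar.of_eq h6
  let E := ZMod.ringEquiv (quadOrder D ⧸ 𝔟) hcard'
  refine ⟨(E.symm : (quadOrder D ⧸ 𝔟) →+* ZMod 6).comp (Ideal.Quotient.mk 𝔟), ?_⟩
  ext x
  rw [RingHom.mem_ker, RingHom.comp_apply, RingHom.coe_coe, EmbeddingLike.map_eq_zero_iff,
    Ideal.Quotient.eq_zero_iff_mem]

theorem exists_ringHom_zmod_two_three {𝔟 : Ideal (quadOrder D)} (h : idealNorm 𝔟 = 6) :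
    ∃ (π₂ : quadOrder D →+* ZMod 2) (π₃ : quadOrder D →+* ZMod 3),
      𝔟 = RingHom.ker π₂ ⊓ RingHom.ker π₃ := by
  obtain ⟨ψ, rfl⟩ := exists_ringHom_zmod_six h
  refine ⟨(ZMod.castHom (by norm_num : 2 ∣ 6) (ZMod 2)).comp ψ,
    (ZMod.castHom (by norm_num : 3 ∣ 6) (ZMod 3)).comp ψ, ?_⟩
  ext x
  simp only [Ideal.mem_inf, RingHom.mem_ker, RingHom.comp_apply]
  generalize ψ x = t
  revert t
  decide

end IdealOfNormSix

/-! ### The index in terms of the conductor -/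

section Index

variable {D : ℕ} (hD : IsDiscriminant D) {p : ℕ} [Fact p.Prime] {𝔞 : Ideal (quadOrder D)}
  (π : quadOrder D →+* ZMod p) {e : quadOrder D} (he : e ∈ 𝔞) (hπe : π e = 1)

include hD he hπe in
theorem hasCosetReps_inf_right {f : ℕ}
    (hf : ∀ N r : ℤ, 4 * N = (D : ℤ) ^ 2 - D → (p : ℤ) ∣ r ^ 2 - D * r + N →
      (((p : ℤ) ∣ 2 * r - D ∧ (p : ℤ) ^ 2 ∣ r ^ 2 - D * r + N) ↔ p ∣ f)) :
    HasCosetReps (hilbertModularGroup 𝔞 ⊓ hilbertModularGroup (𝔞 ⊓ RingHom.ker π))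
      (hilbertModularGroup (𝔞 ⊓ RingHom.ker π)) (if p ∣ f then p else p + 1) := by
  obtain ⟨r, hr⟩ := ZMod.intCast_surjective (extendZero π (gammaD D))
  obtain ⟨N, hN⟩ := exists_normForm hD
  have h := hf N r hN (dvd_normForm π hr.symm hN)
  split_ifs with hpf
  · obtain ⟨h1, h2⟩ := h.2 hpf
    exact hasCosetReps_inf_right_of_dvd hD π he hπe hr.symm hN h1 h2
  · exact hasCosetReps_inf_right_of_not_dvd hD π he hπe hr.symm hN fun h0 => hpf (h.1 h0)

end Index

/-! ### The two real embeddings -/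

section Embeddings

variable {D : ℕ}

theorem σ₁_apply (x : QuadField D) : σ₁ D x = x.re + x.im * √(D : ℝ) := by
  simp [σ₁, realEmbedding, QuadraticAlgebra.lift, Algebra.smul_def]

theorem σ₂_apply (x : QuadField D) : σ₂ D x = x.re - x.im * √(D : ℝ) := by
  simp [σ₂, realEmbedding, QuadraticAlgebra.lift, Algebra.smul_def, sub_eq_add_neg]

theorem σ₁_sub_σ₂_gammaD : σ₁ D (gammaD D) - σ₂ D (gammaD D) = √(D : ℝ) := by
  rw [σ₁_apply, σ₂_apply]
  simp [gammaD]
  ring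

theorem σ₁_injective (hsq : ¬ IsSquare D) : Function.Injective (σ₁ D) := by
  rw [injective_iff_map_eq_zero]
  intro x hx
  rw [σ₁_apply] at hx
  have hirr : Irrational √(D : ℝ) := irrational_sqrt_natCast_iff.2 hsq
  by_cases him : x.im = 0
  · rw [him] at hx
    have : x.re = 0 := by simpa using hx
    ext <;> simp [this, him]
  · exfalso
    refine hirr ⟨-x.re / x.im, ?_⟩
    have : (x.im : ℝ) ≠ 0 := by exact_mod_cast him
    push_cast
    field_simp
    linarith

instance : Countable (QuadField D) := (QuadraticAlgebra.equivProd (D : ℚ) 0).injective.countable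

instance : Countable SL(2, QuadField D) := by
  have : Countable (Matrix (Fin 2) (Fin 2) (QuadField D)) :=
    inferInstanceAs (Countable (Fin 2 → Fin 2 → QuadField D))
  exact Subtype.countable

instance (H : Subgroup SL(2, QuadField D)) : Countable (H.map (moebius D)) := by
  have : ((H.map (moebius D) : Subgroup _) : Set (Equiv.Perm (ℍ × ℍ))).Countable := by
    rw [Subgroup.coe_map]
    exact (Set.to_countable _).image _
  exact this.to_subtype

instance (𝔞 : Ideal (quadOrder D)) : Countable (transformationGroup 𝔞) :=
  inferInstanceAs (Countable ((hilbertModularGroup 𝔞).map (moebius D)))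

/-- The order is discrete in ℝ²: the two embeddings of u + vγ_D differ by v√D, which bounds v and
then u. -/
theorem finite_setOf_abs_le (hD : IsDiscriminant D) {m : ℤ} (hm : m ≠ 0) (R : ℝ) :
    {x : QuadField D | (m : QuadField D) * x ∈ quadOrder D ∧ |σ₁ D x| ≤ R ∧ |σ₂ D x| ≤ R}.Finite := by
  have hs : (1 : ℝ) ≤ √(D : ℝ) := Real.one_le_sqrt.2 (by exact_mod_cast hD.1)
  set A : ℤ := ⌈2 * |(m : ℝ)| * R⌉
  set B : ℤ := ⌈|(m : ℝ)| * R + A * |σ₁ D (gammaD D)|⌉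
  refine Set.Finite.subset (((Set.finite_Icc (-B) B).prod (Set.finite_Icc (-A) A)).image
    fun w : ℤ × ℤ => (m : ℚ)⁻¹ • ((w.1 : QuadField D) + (w.2 : QuadField D) * gammaD D)) ?_
  rintro x ⟨hx, h1, h2⟩
  obtain ⟨u, v, huv⟩ := (mem_quadOrder_iff hD).1 hx
  have e1 : (m : ℝ) * σ₁ D x = u + v * σ₁ D (gammaD D) := by simpa using congrArg (σ₁ D) huv
  have e2 : (m : ℝ) * σ₂ D x = u + v * σ₂ D (gammaD D) := by simpa using congrArg (σ₂ D) huv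
  have hv : |(v : ℝ)| ≤ A := by
    refine le_trans ?_ (Int.le_ceil _)
    calc |(v : ℝ)| ≤ |(v : ℝ)| * √(D : ℝ) := le_mul_of_one_le_right (abs_nonneg _) hs
      _ = |(v : ℝ) * √(D : ℝ)| := by rw [abs_mul, abs_of_nonneg (Real.sqrt_nonneg _)]
      _ = |(m : ℝ) * (σ₁ D x - σ₂ D x)| := by
        congr 1
        rw [← σ₁_sub_σ₂_gammaD]
        linear_combination e2 - e1
      _ = |(m : ℝ)| * |σ₁ D x - σ₂ D x| := abs_mul _ _
      _ ≤ |(m : ℝ)| * (R + R) :=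
        mul_le_mul_of_nonneg_left ((abs_sub _ _).trans (add_le_add h1 h2)) (abs_nonneg _)
      _ = 2 * |(m : ℝ)| * R := by ring
  have hu : |(u : ℝ)| ≤ B := by
    refine le_trans ?_ (Int.le_ceil _)
    calc |(u : ℝ)| = |(m : ℝ) * σ₁ D x - v * σ₁ D (gammaD D)| := by
          congr 1
          linear_combination -e1
      _ ≤ |(m : ℝ) * σ₁ D x| + |(v : ℝ) * σ₁ D (gammaD D)| := abs_sub _ _
      _ = |(m : ℝ)| * |σ₁ D x| + |(v : ℝ)| * |σ₁ D (gammaD D)| := by rw [abs_mul, abs_mul]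
      _ ≤ _ := by gcongr
  refine ⟨(u, v), ⟨?_, ?_⟩, ?_⟩
  · exact abs_le.1 (by exact_mod_cast hu)
  · exact abs_le.1 (by exact_mod_cast hv)
  · have hm' : (m : ℚ) ≠ 0 := by exact_mod_cast hm
    simp only [← huv]
    ext <;> simp [hm']

end Embeddings

/-! ### Invariance of the measure, the kernel, and fixed points -/

section Moebius

variable {D : ℕ}

theorem moebius_apply (g : SL(2, QuadField D)) (z : ℍ × ℍ) :
    moebius D g z = ((Matrix.SpecialLinearGroup.map (σ₁ D) g : SL(2, ℝ)) • z.1,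
      (Matrix.SpecialLinearGroup.map (σ₂ D) g : SL(2, ℝ)) • z.2) := rfl

instance : SMulInvariantMeasure SL(2, ℝ) ℍ volume :=
  ⟨fun g s _ => measure_preimage_smul (volume : Measure ℍ)
    (Matrix.SpecialLinearGroup.mapGL ℝ g : GL (Fin 2) ℝ) s⟩

instance : SFinite eulerMeasure := by unfold eulerMeasure; infer_instance

theorem measurePreserving_moebius (g : SL(2, QuadField D)) :
    MeasurePreserving (moebius D g) eulerMeasure eulerMeasure := by
  have h : ∀ g : SL(2, ℝ), MeasurePreserving (fun z : ℍ => g • z)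
      (ENNReal.ofReal (1 / (2 * Real.pi)) • volume) (ENNReal.ofReal (1 / (2 * Real.pi)) • volume) :=
    fun g => (measurePreserving_smul g volume).smul_measure _
  exact (h _).prod (h _)

theorem continuous_moebius (g : SL(2, QuadField D)) : Continuous (moebius D g) :=
  ((continuous_const_smul (Matrix.SpecialLinearGroup.map (σ₁ D) g : SL(2, ℝ))).comp
    continuous_fst).prodMk
  ((continuous_const_smul (Matrix.SpecialLinearGroup.map (σ₂ D) g : SL(2, ℝ))).comp continuous_snd)

/-- A fixed point is a root of cz² + (d - a)z - b; the two conditions are the sum and the product of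
its pair of conjugate roots. -/
theorem smul_eq_iff (g : SL(2, ℝ)) (z : ℍ) : g • z = z ↔
    2 * g 1 0 * z.re = g 0 0 - g 1 1 ∧ g 1 0 * (z.re ^ 2 + z.im ^ 2) = - g 0 1 := by
  have hden : ((g 1 0 : ℝ) : ℂ) * z + (g 1 1 : ℝ) ≠ 0 := UpperHalfPlane.denom_ne_zero g z
  rw [UpperHalfPlane.ext_iff, UpperHalfPlane.coe_specialLinearGroup_apply]
  simp only [Algebra.algebraMap_self, RingHom.id_apply]
  rw [div_eq_iff hden, Complex.ext_iff]
  have hy := z.im_pos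
  simp
  constructor
  · rintro ⟨h1, h2⟩
    have h3 : 2 * g 1 0 * z.re = g 0 0 - g 1 1 := by
      apply mul_right_cancel₀ hy.ne'
      linear_combination -h2
    refine ⟨h3, ?_⟩
    linear_combination h1 + z.re * h3
  · rintro ⟨h1, h2⟩
    constructor
    · linear_combination h2 - z.re * h1
    · linear_combination -z.im * h1

theorem eq_zero_of_smul_eq {g : SL(2, ℝ)} {z w : ℍ} (hz : g • z = z) (hw : g • w = w)
    (hzw : z ≠ w) : g 1 0 = 0 ∧ g 0 1 = 0 ∧ g 0 0 = g 1 1 := by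
  rw [smul_eq_iff] at hz hw
  have hc : g 1 0 = 0 := by
    by_contra hc
    refine hzw ?_
    have h1 : z.re = w.re := mul_left_cancel₀ (mul_ne_zero two_ne_zero hc) (hz.1.trans hw.1.symm)
    have h2 := mul_left_cancel₀ hc (hz.2.trans hw.2.symm)
    rw [h1] at h2
    have h3 : z.im = w.im := by
      have := z.im_pos
      have := w.im_pos
      nlinarith
    exact UpperHalfPlane.ext_re_im h1 h3
  refine ⟨hc, ?_, ?_⟩
  · have := hz.2
    rw [hc] at this
    linarith
  · have := hz.1
    rw [hc] at this
    linarith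

theorem eq_one_or_eq_neg_one (hsq : ¬ IsSquare D) {g : SL(2, QuadField D)} {z w : ℍ}
    (hz : (Matrix.SpecialLinearGroup.map (σ₁ D) g : SL(2, ℝ)) • z = z)
    (hw : (Matrix.SpecialLinearGroup.map (σ₁ D) g : SL(2, ℝ)) • w = w) (hzw : z ≠ w) :
    g = 1 ∨ g = -1 := by
  obtain ⟨h1, h2, h3⟩ := eq_zero_of_smul_eq hz hw hzw
  have hinj := σ₁_injective hsq
  have h1' : g 1 0 = 0 := hinj (by rw [map_zero]; exact h1)
  have h2' : g 0 1 = 0 := hinj (by rw [map_zero]; exact h2)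
  have h3' : g 0 0 = g 1 1 := hinj h3
  have hdet := det_eq_one g
  rw [h1', h2', ← h3', mul_zero, sub_zero] at hdet
  have hσ : σ₁ D (g 0 0) * σ₁ D (g 0 0) = 1 := by rw [← map_mul, hdet, map_one]
  rcases mul_self_eq_one_iff.1 hσ with h | h
  · left
    have h0 : g 0 0 = 1 := hinj (by rw [h, map_one])
    refine Matrix.SpecialLinearGroup.ext _ _ fun i j => ?_
    fin_cases i <;> fin_cases j <;> simp [h0, h1', h2', ← h3']
  · right
    have h0 : g 0 0 = -1 := hinj (by rw [h, map_neg, map_one])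
    refine Matrix.SpecialLinearGroup.ext _ _ fun i j => ?_
    fin_cases i <;> fin_cases j <;> simp [h0, h1', h2', ← h3']

theorem neg_one_mem_hilbertModularGroup (𝔞 : Ideal (quadOrder D)) :
    -1 ∈ hilbertModularGroup 𝔞 := by
  refine ⟨?_, ?_, ⟨0, 𝔞.zero_mem, by simp⟩, fun z _ => by simp⟩
  · simp
  · simp

theorem moebius_neg_one : moebius D (-1) = 1 := by
  refine Equiv.ext fun z => Prod.ext ((smul_eq_iff _ _).2 ?_) ((smul_eq_iff _ _).2 ?_) <;> simp

/-- An element acting trivially fixes both i and i + 1, hence is ±1. This lets indices of matrix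
groups pass to transformation groups. -/
theorem ker_moebius_le (hsq : ¬ IsSquare D) (𝔞 : Ideal (quadOrder D)) :
    (moebius D).ker ≤ hilbertModularGroup 𝔞 := by
  intro g hg
  rw [MonoidHom.mem_ker] at hg
  have h : ∀ z : ℍ, (Matrix.SpecialLinearGroup.map (σ₁ D) g : SL(2, ℝ)) • z = z := fun z => by
    have := congrArg (fun e : Equiv.Perm (ℍ × ℍ) => (e (z, z)).1) hg
    exact this
  have hne : UpperHalfPlane.I ≠ (1 : ℝ) +ᵥ UpperHalfPlane.I := fun h0 => by
    have := congrArg UpperHalfPlane.re h0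
    simp at this
  rcases eq_one_or_eq_neg_one hsq (h _) (h _) hne with rfl | rfl
  · exact one_mem _
  · exact neg_one_mem_hilbertModularGroup 𝔞

instance : NullSingletonClass (volume : Measure ℍ) := ⟨fun z => by
  rw [UpperHalfPlane.volume_eq_lintegral, Set.image_singleton]
  exact setLIntegral_measure_zero _ _ (measure_singleton _)⟩

/-- The first coordinate of a fixed point takes at most one value, and vertical slices are null. -/
theorem eulerMeasure_fixedPoints (hsq : ¬ IsSquare D) {g : SL(2, QuadField D)}
    (hg : moebius D g ≠ 1) : eulerMeasure {z | moebius D g z = z} = 0 := by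
  set s : Set ℍ := {z | (Matrix.SpecialLinearGroup.map (σ₁ D) g : SL(2, ℝ)) • z = z}
  have hs : s.Subsingleton := by
    intro z hz w hw
    by_contra hzw
    rcases eq_one_or_eq_neg_one hsq hz hw hzw with rfl | rfl
    · exact hg (map_one _)
    · exact hg moebius_neg_one
  refine measure_mono_null (t := s ×ˢ Set.univ) (fun z hz => ⟨congrArg Prod.fst hz, trivial⟩) ?_
  rw [eulerMeasure, Measure.prod_prod, Measure.smul_apply, hs.measure_zero, smul_zero, zero_mul]

end Moebius

/-! ### Proper discontinuity of the action -/

section ProperDiscontinuity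

variable {D : ℕ}

/-- SL₂(ℝ) acts properly on ℍ, so these g form a compact set, on which the entries are bounded. -/
theorem exists_abs_apply_le {K L : Set ℍ} (hK : IsCompact K) (hL : IsCompact L) :
    ∃ R : ℝ, ∀ g : SL(2, ℝ), (∃ z ∈ K, g • z ∈ L) → ∀ i j, |g i j| ≤ R := by
  have hc : IsCompact (Prod.fst '' ((fun w : SL(2, ℝ) × ℍ => (w.1 • w.2, w.2)) ⁻¹' (L ×ˢ K))) :=
    ((ProperSMul.isProperMap_smul_pair (G := SL(2, ℝ)) (X := ℍ)).isCompact_preimage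
      (hL.prod hK)).image continuous_fst
  have hb : ∀ i j, ∃ R : ℝ, ∀ g ∈ Prod.fst '' ((fun w : SL(2, ℝ) × ℍ => (w.1 • w.2, w.2)) ⁻¹'
      (L ×ˢ K)), |g i j| ≤ R := by
    intro i j
    obtain ⟨R, hR⟩ := hc.exists_bound_of_continuousOn (f := fun g : SL(2, ℝ) => g i j)
      (Continuous.matrix_elem continuous_subtype_val i j).continuousOn
    exact ⟨R, hR⟩
  choose R hR using hb
  refine ⟨∑ i, ∑ j, |R i j|, fun g ⟨z, hz, hgz⟩ i j => ?_⟩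
  refine (hR i j g ⟨(g, z), ⟨hgz, hz⟩, rfl⟩).trans ((le_abs_self _).trans ?_)
  exact (Finset.single_le_sum (f := fun j => |R i j|) (fun _ _ => abs_nonneg _)
    (Finset.mem_univ j)).trans (Finset.single_le_sum (f := fun i => ∑ j, |R i j|)
    (fun _ _ => Finset.sum_nonneg fun _ _ => abs_nonneg _) (Finset.mem_univ i))

theorem sqrtD_mem : sqrtD D ∈ quadOrder D := by
  have : sqrtD D = gammaD D + gammaD D - D := by
    ext <;> simp [sqrtD, gammaD]
    norm_num
  rw [this]
  exact sub_mem (add_mem gammaD_mem gammaD_mem) (natCast_mem _ D)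

theorem sqrtD_mul_self : sqrtD D * sqrtD D = (D : QuadField D) := by
  ext <;> simp [sqrtD]

theorem mul_apply_mem {𝔞 : Ideal (quadOrder D)} {n : ℤ} (hn : (n : quadOrder D) ∈ 𝔞)
    {g : SL(2, QuadField D)} (hg : g ∈ hilbertModularGroup 𝔞) (i j : Fin 2) :
    ((n * D : ℤ) : QuadField D) * g i j ∈ quadOrder D := by
  obtain ⟨h1, h2, ⟨y, -, hy⟩, h4⟩ := hg
  fin_cases i <;> fin_cases j
  · exact mul_mem (intCast_mem _ _) h1
  · refine mul_mem (intCast_mem _ _) ?_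
    change g 0 1 ∈ _
    rw [hy]
    exact mul_mem sqrtD_mem y.2
  · have := mul_mem sqrtD_mem (h4 _ hn)
    convert this using 1
    simp only [Fin.mk_one, Fin.zero_eta]
    push_cast
    linear_combination -(n : QuadField D) * g 1 0 * sqrtD_mul_self
  · exact mul_mem (intCast_mem _ _) h2

/-- The entries have the common denominator nD and are bounded in both embeddings, so only finitely
many matrices are possible. -/
theorem properlyDiscontinuousSMul_transformationGroup (hD : IsDiscriminant D)
    {𝔞 : Ideal (quadOrder D)} {n : ℤ} (hn0 : n ≠ 0) (hn : (n : quadOrder D) ∈ 𝔞) :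
    ProperlyDiscontinuousSMul (transformationGroup 𝔞) (ℍ × ℍ) := by
  refine ⟨fun {K L} hK hL => ?_⟩
  obtain ⟨R₁, h1⟩ := exists_abs_apply_le (hK.image continuous_fst) (hL.image continuous_fst)
  obtain ⟨R₂, h2⟩ := exists_abs_apply_le (hK.image continuous_snd) (hL.image continuous_snd)
  have hm : n * D ≠ 0 := mul_ne_zero hn0 (by exact_mod_cast hD.1.ne')
  have hfin := finite_setOf_abs_le hD hm (max R₁ R₂)
  have hfin2 : {g : SL(2, QuadField D) | ∀ i j, g i j ∈ {x : QuadField D |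
      ((n * D : ℤ) : QuadField D) * x ∈ quadOrder D ∧ |σ₁ D x| ≤ max R₁ R₂ ∧
      |σ₂ D x| ≤ max R₁ R₂}}.Finite := by
    refine Set.Finite.of_injOn (f := fun g : SL(2, QuadField D) => fun i j => g i j)
      (t := Set.pi Set.univ fun _ => Set.pi Set.univ fun _ => _) (fun g hg => ?_) (fun g _ h _ hgh => ?_)
      (Set.Finite.pi fun _ => Set.Finite.pi fun _ => hfin)
    · exact fun i _ j _ => hg i j
    · refine Matrix.SpecialLinearGroup.ext _ _ fun i j => ?_
      exact congrFun (congrFun hgh i) j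
  refine Set.Finite.of_finite_image (f := Subtype.val) ?_ Subtype.val_injective.injOn
  refine (hfin2.image (moebius D)).subset ?_
  rintro _ ⟨⟨_, g, hg, rfl⟩, ⟨_, ⟨z, hz, rfl⟩, hz'⟩, rfl⟩
  refine ⟨g, fun i j => ⟨mul_apply_mem hn hg i j, ?_, ?_⟩, rfl⟩
  · exact (h1 (Matrix.SpecialLinearGroup.map (σ₁ D) g)
      ⟨z.1, ⟨z, hz, rfl⟩, ⟨_, hz', rfl⟩⟩ i j).trans (le_max_left _ _)
  · exact (h2 (Matrix.SpecialLinearGroup.map (σ₂ D) g)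
      ⟨z.2, ⟨z, hz, rfl⟩, ⟨_, hz', rfl⟩⟩ i j).trans (le_max_right _ _)

instance (H : Subgroup SL(2, QuadField D)) : ContinuousConstSMul (H.map (moebius D)) (ℍ × ℍ) :=
  ⟨by rintro ⟨_, g, -, rfl⟩; exact continuous_moebius g⟩

instance (H : Subgroup SL(2, QuadField D)) :
    SMulInvariantMeasure (H.map (moebius D)) (ℍ × ℍ) eulerMeasure :=
  ⟨by
    rintro ⟨_, g, -, rfl⟩ s hs
    exact (measurePreserving_moebius g).measure_preimage hs.nullMeasurableSet⟩

instance (𝔞 : Ideal (quadOrder D)) : ContinuousConstSMul (transformationGroup 𝔞) (ℍ × ℍ) :=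
  inferInstanceAs (ContinuousConstSMul ((hilbertModularGroup 𝔞).map (moebius D)) (ℍ × ℍ))

instance (𝔞 : Ideal (quadOrder D)) :
    SMulInvariantMeasure (transformationGroup 𝔞) (ℍ × ℍ) eulerMeasure :=
  inferInstanceAs
    (SMulInvariantMeasure ((hilbertModularGroup 𝔞).map (moebius D)) (ℍ × ℍ) eulerMeasure)

theorem exists_isFundamentalDomain (hD : IsDiscriminant D) (hsq : ¬ IsSquare D)
    {𝔞 : Ideal (quadOrder D)} {n : ℤ} (hn0 : n ≠ 0) (hn : (n : quadOrder D) ∈ 𝔞) :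
    ∃ s : Set (ℍ × ℍ), IsFundamentalDomain (transformationGroup 𝔞) s eulerMeasure := by
  have := properlyDiscontinuousSMul_transformationGroup hD hn0 hn
  refine exists_isFundamentalDomain_of_properlyDiscontinuousSMul eulerMeasure ?_
  rintro ⟨_, g, hg, rfl⟩ hne
  exact eulerMeasure_fixedPoints hsq fun h => hne (Subtype.ext h)

end ProperDiscontinuity

/-! ### Approximation and approximate division over the order -/

section Lattice

variable {D : ℕ}

theorem sqrt_le_self (hD : IsDiscriminant D) : √(D : ℝ) ≤ D := by
  rw [Real.sqrt_le_left (Nat.cast_nonneg D)]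
  have : (1 : ℝ) ≤ D := by exact_mod_cast hD.1
  nlinarith

theorem abs_σ₁_gammaD_le (hD : IsDiscriminant D) : |σ₁ D (gammaD D)| ≤ D := by
  rw [σ₁_apply]
  have h1 := sqrt_le_self hD
  have h2 := Real.sqrt_nonneg (D : ℝ)
  simp [gammaD]
  rw [abs_le]
  constructor <;> linarith

theorem abs_σ₂_gammaD_le (hD : IsDiscriminant D) : |σ₂ D (gammaD D)| ≤ D := by
  rw [σ₂_apply]
  have h1 := sqrt_le_self hD
  have h2 := Real.sqrt_nonneg (D : ℝ)
  simp [gammaD]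
  rw [abs_le]
  constructor <;> linarith

/-- Real coordinates on `ℝ²` with respect to the lattice basis `1, γ_D` of the order. -/
theorem exists_real_coordinates (hD : IsDiscriminant D) (x₁ x₂ : ℝ) :
    ∃ s t : ℝ, x₁ = s + t * σ₁ D (gammaD D) ∧ x₂ = s + t * σ₂ D (gammaD D) := by
  have h0 : √(D : ℝ) ≠ 0 := (Real.sqrt_pos.2 (by exact_mod_cast hD.1)).ne'
  refine ⟨x₁ - (x₁ - x₂) / √(D : ℝ) * σ₁ D (gammaD D), (x₁ - x₂) / √(D : ℝ), by ring, ?_⟩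
  have h := σ₁_sub_σ₂_gammaD (D := D)
  have : (x₁ - x₂) / √(D : ℝ) * (σ₁ D (gammaD D) - σ₂ D (gammaD D)) = x₁ - x₂ := by
    rw [h, div_mul_cancel₀ _ h0]
  linarith

theorem abs_add_mul_le {s t a b δ : ℝ} (hs : |s| ≤ δ) (ht : |t| ≤ δ) (ha : |a| ≤ b) :
    |s + t * a| ≤ (1 + b) * δ := by
  have hδ : 0 ≤ δ := (abs_nonneg s).trans hs
  calc |s + t * a| ≤ |s| + |t * a| := abs_add_le _ _
    _ = |s| + |t| * |a| := by rw [abs_mul]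
    _ ≤ δ + δ * b := add_le_add hs (mul_le_mul ht ha (abs_nonneg _) hδ)
    _ = (1 + b) * δ := by ring

/-- The pigeonhole principle for the torus `ℝ² / 𝓞_D`. -/
theorem exists_ne_close {ι : Type*} [Fintype ι] (hD : IsDiscriminant D) (x₁ x₂ : ι → ℝ) {T : ℕ}
    (hT : 0 < T) (hι : T ^ 2 < Fintype.card ι) :
    ∃ i j, i ≠ j ∧ ∃ d ∈ quadOrder D, |x₁ i - x₁ j + σ₁ D d| ≤ (1 + D) * (1 / T) ∧
      |x₂ i - x₂ j + σ₂ D d| ≤ (1 + D) * (1 / T) := by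
  choose s t h1 h2 using fun i => exists_real_coordinates hD (x₁ i) (x₂ i)
  have hT' : (0 : ℝ) < T := by exact_mod_cast hT
  have hbox : ∀ y : ℝ, ⌊T * Int.fract y⌋₊ < T := fun y => by
    rw [Nat.floor_lt (by positivity)]
    exact mul_lt_of_lt_one_right hT' (Int.fract_lt_one y)
  have hclose : ∀ y z : ℝ, ⌊T * Int.fract y⌋₊ = ⌊T * Int.fract z⌋₊ →
      |Int.fract y - Int.fract z| ≤ 1 / T := by
    intro y z h
    have a1 := Nat.floor_le (a := T * Int.fract y) (by positivity)
    have a2 := Nat.lt_floor_add_one (T * Int.fract y)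
    have b1 := Nat.floor_le (a := T * Int.fract z) (by positivity)
    have b2 := Nat.lt_floor_add_one (T * Int.fract z)
    rw [h] at a1 a2
    have e1 : |(Int.fract y - Int.fract z) * T| = |Int.fract y - Int.fract z| * T := by
      rw [abs_mul, abs_of_pos hT']
    rw [le_div_iff₀ hT', ← e1, abs_le]
    constructor <;> nlinarith
  obtain ⟨i, j, hij, hf⟩ := Fintype.exists_ne_map_eq_of_card_lt
    (fun i => ((⟨_, hbox (s i)⟩, ⟨_, hbox (t i)⟩) : Fin T × Fin T))
    (by simpa [pow_two] using hι)
  simp only [Prod.mk.injEq, Fin.mk.injEq] at hf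
  have hs := hclose _ _ hf.1
  have ht := hclose _ _ hf.2
  refine ⟨i, j, hij, ((⌊s j⌋ - ⌊s i⌋ : ℤ) : QuadField D) + ((⌊t j⌋ - ⌊t i⌋ : ℤ) : QuadField D) *
    gammaD D, (mem_quadOrder_iff hD).2 ⟨_, _, rfl⟩, ?_, ?_⟩
  · have := abs_add_mul_le hs ht (abs_σ₁_gammaD_le hD)
    convert this using 2
    rw [h1, h1, map_add, map_mul, map_intCast, map_intCast]
    simp only [Int.fract]
    push_cast
    ring
  · have := abs_add_mul_le hs ht (abs_σ₂_gammaD_le hD)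
    convert this using 2
    rw [h2, h2, map_add, map_mul, map_intCast, map_intCast]
    simp only [Int.fract]
    push_cast
    ring

theorem exists_add_mem_quadOrder_le (hD : IsDiscriminant D) (x₁ x₂ : ℝ) :
    ∃ d ∈ quadOrder D, |x₁ + σ₁ D d| ≤ 1 + D ∧ |x₂ + σ₂ D d| ≤ 1 + D := by
  obtain ⟨s, t, h1, h2⟩ := exists_real_coordinates hD x₁ x₂
  have hfr : ∀ y : ℝ, |Int.fract y| ≤ 1 := fun y => by
    rw [abs_of_nonneg (Int.fract_nonneg y)]
    exact (Int.fract_lt_one y).le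
  refine ⟨((-⌊s⌋ : ℤ) : QuadField D) + ((-⌊t⌋ : ℤ) : QuadField D) * gammaD D,
    (mem_quadOrder_iff hD).2 ⟨_, _, rfl⟩, ?_, ?_⟩
  · have := abs_add_mul_le (hfr s) (hfr t) (abs_σ₁_gammaD_le hD)
    rw [mul_one] at this
    convert this using 2
    rw [h1, map_add, map_mul, map_intCast, map_intCast]
    simp only [Int.fract]
    push_cast
    ring
  · have := abs_add_mul_le (hfr s) (hfr t) (abs_σ₂_gammaD_le hD)
    rw [mul_one] at this
    convert this using 2
    rw [h2, map_add, map_mul, map_intCast, map_intCast]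
    simp only [Int.fract]
    push_cast
    ring

/-- Simultaneous Dirichlet approximation over the order. -/
theorem exists_approximation (hD : IsDiscriminant D) (x₁ x₂ : ℝ) {T : ℕ} (hT : 0 < T) :
    ∃ c ∈ quadOrder D, ∃ d ∈ quadOrder D, c ≠ 0 ∧
      |σ₁ D c| ≤ (1 + D) * T ∧ |σ₂ D c| ≤ (1 + D) * T ∧
      |σ₁ D c * x₁ + σ₁ D d| ≤ (1 + D) * (1 / T) ∧
      |σ₂ D c * x₂ + σ₂ D d| ≤ (1 + D) * (1 / T) := by
  -- There are (T + 1)² > T² candidates, enough for the pigeonhole principle.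
  let c : Fin (T + 1) × Fin (T + 1) → QuadField D := fun w =>
    ((w.1 : ℕ) : ℤ) + (((w.2 : ℕ) : ℤ) : QuadField D) * gammaD D
  obtain ⟨i, j, hij, d, hd, h1, h2⟩ := exists_ne_close hD (fun w => σ₁ D (c w) * x₁)
    (fun w => σ₂ D (c w) * x₂) hT (by simp; nlinarith)
  have hc : c i - c j = (((i.1 : ℕ) - (j.1 : ℕ) : ℤ) : QuadField D) +
      (((i.2 : ℕ) - (j.2 : ℕ) : ℤ) : QuadField D) * gammaD D := by
    simp only [c]
    push_cast
    ring
  have hle : ∀ a b : Fin (T + 1), |(((a : ℕ) - (b : ℕ) : ℤ) : ℝ)| ≤ T := fun a b => by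
    have h : |((a : ℕ) - (b : ℕ) : ℤ)| ≤ T := by
      rw [abs_le]
      constructor <;> omega
    exact_mod_cast h
  refine ⟨c i - c j, hc ▸ (mem_quadOrder_iff hD).2 ⟨_, _, rfl⟩, d, hd, ?_, ?_, ?_, ?_, ?_⟩
  · intro h0
    obtain ⟨e1, e2⟩ := intCast_add_mul_gammaD_inj (sub_eq_zero.1 h0)
    exact hij (Prod.ext (Fin.ext (by exact_mod_cast e1)) (Fin.ext (by exact_mod_cast e2)))
  · rw [hc, map_add, map_mul, map_intCast, map_intCast]
    exact abs_add_mul_le (hle _ _) (hle _ _) (abs_σ₁_gammaD_le hD)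
  · rw [hc, map_add, map_mul, map_intCast, map_intCast]
    exact abs_add_mul_le (hle _ _) (hle _ _) (abs_σ₂_gammaD_le hD)
  · rwa [map_sub, sub_mul]
  · rwa [map_sub, sub_mul]

/-- A substitute for division with remainder in the order: a bounded multiple of every element
of `K` is close to an element of the order. -/
theorem exists_mul_sub_abs_lt_one (hD : IsDiscriminant D) : ∃ M : ℕ, ∀ ξ : QuadField D,
    ∃ t : ℕ, 0 < t ∧ t ≤ M ∧ ∃ y ∈ quadOrder D,
      |σ₁ D ((t : QuadField D) * ξ - y)| < 1 ∧ |σ₂ D ((t : QuadField D) * ξ - y)| < 1 := by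
  -- With T = 2 + D the pigeonhole error (1 + D)/T is below 1; it needs T² + 1 multiples of ξ.
  refine ⟨(2 + D) ^ 2, fun ξ => ?_⟩
  obtain ⟨i, j, hij, d, hd, h1, h2⟩ := exists_ne_close (ι := Fin ((2 + D) ^ 2 + 1)) hD
    (fun i => (i : ℕ) * σ₁ D ξ) (fun i => (i : ℕ) * σ₂ D ξ) (T := 2 + D) (by omega) (by simp)
  have hlt : (1 + (D : ℝ)) * (1 / ((2 + D : ℕ) : ℝ)) < 1 := by
    rw [mul_one_div, div_lt_one (by positivity)]
    push_cast
    linarith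
  have h1 := h1.trans_lt hlt
  have h2 := h2.trans_lt hlt
  rcases lt_or_gt_of_ne hij with h | h
  · refine ⟨j - i, by omega, by omega, d, hd, ?_, ?_⟩
    · rw [← abs_neg]
      refine lt_of_eq_of_lt (congrArg _ ?_) h1
      rw [Nat.cast_sub (by exact_mod_cast h.le)]
      simp
      ring
    · rw [← abs_neg]
      refine lt_of_eq_of_lt (congrArg _ ?_) h2
      rw [Nat.cast_sub (by exact_mod_cast h.le)]
      simp
      ring
  · refine ⟨i - j, by omega, by omega, -d, neg_mem hd, ?_, ?_⟩
    · refine lt_of_eq_of_lt (congrArg _ ?_) h1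
      rw [Nat.cast_sub (by exact_mod_cast h.le)]
      simp
      ring
    · refine lt_of_eq_of_lt (congrArg _ ?_) h2
      rw [Nat.cast_sub (by exact_mod_cast h.le)]
      simp
      ring

theorem exists_norm_eq (hD : IsDiscriminant D) {x : QuadField D} (hx : x ∈ quadOrder D) :
    ∃ n : ℕ, |σ₁ D x * σ₂ D x| = n := by
  obtain ⟨N, hN⟩ := exists_normForm hD
  obtain ⟨u, v, rfl⟩ := (mem_quadOrder_iff hD).1 hx
  refine ⟨(u ^ 2 + D * u * v + N * v ^ 2).natAbs, ?_⟩
  rw [Nat.cast_natAbs, Int.cast_abs]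
  congr 1
  have hN' : (4 : ℝ) * N = (D : ℝ) ^ 2 - D := by exact_mod_cast hN
  have hs : √(D : ℝ) * √(D : ℝ) = D := Real.mul_self_sqrt (Nat.cast_nonneg D)
  rw [σ₁_apply, σ₂_apply]
  simp [gammaD]
  linear_combination (-(v : ℝ) ^ 2 / 4) * hs - (v : ℝ) ^ 2 / 4 * hN'

theorem σ₂_injective (hsq : ¬ IsSquare D) : Function.Injective (σ₂ D) := by
  intro x y hxy
  have h : star x = star y := by
    apply σ₁_injective hsq
    rw [σ₂_apply, σ₂_apply] at hxy
    rw [σ₁_apply, σ₁_apply]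
    simp
    linarith
  exact star_injective h

theorem exists_mul_eq_one (hsq : ¬ IsSquare D) {x : QuadField D} (hx : x ≠ 0) :
    ∃ y : QuadField D, x * y = 1 := by
  have h : QuadraticAlgebra.norm x ≠ 0 := by
    intro h0
    have h1 := QuadraticAlgebra.algebraMap_norm_eq_mul_star x
    rw [h0, map_zero] at h1
    have h2 := congrArg (σ₁ D) h1.symm
    rw [map_mul, map_zero, mul_eq_zero, map_eq_zero_iff _ (σ₁_injective hsq),
      map_eq_zero_iff _ (σ₁_injective hsq), star_eq_zero, or_self] at h2
    exact hx h2
  exact (QuadraticAlgebra.isUnit_iff_norm_isUnit.2 (isUnit_iff_ne_zero.2 h)).exists_right_inv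

/-- There is a positive integer `m` such that every nonzero pair in `𝓞_D²` is proportional to the
bottom row of an integral matrix of determinant `m`. -/
theorem exists_completion (hD : IsDiscriminant D) (hsq : ¬ IsSquare D) : ∃ m : ℕ, 0 < m ∧
    ∀ c ∈ quadOrder D, ∀ d ∈ quadOrder D, c ≠ 0 → ∃ x ∈ quadOrder D, ∃ y ∈ quadOrder D,
      ∃ u ∈ quadOrder D, ∃ v ∈ quadOrder D, x * v - y * u = m ∧ ∃ a : QuadField D,
      1 ≤ |σ₁ D a * σ₂ D a| ∧ m * c = a * u ∧ m * d = a * v := by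
  obtain ⟨M, hM⟩ := exists_mul_sub_abs_lt_one hD
  refine ⟨M.factorial, M.factorial_pos, fun c hc d hd hc0 => ?_⟩
  have hinj₁ := σ₁_injective hsq
  have hinj₂ := σ₂_injective hsq
  -- A nonzero combination of c and d of minimal norm replaces their greatest common divisor.
  let P : ℕ → Prop := fun n => ∃ x ∈ quadOrder D, ∃ y ∈ quadOrder D, x * d - y * c ≠ 0 ∧
    |σ₁ D (x * d - y * c) * σ₂ D (x * d - y * c)| = n
  have hmem : ∀ x ∈ quadOrder D, ∀ y ∈ quadOrder D, x * d - y * c ∈ quadOrder D :=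
    fun x hx y hy => sub_mem (mul_mem hx hd) (mul_mem hy hc)
  have hP : ∃ n, P n := by
    obtain ⟨n, hn⟩ := exists_norm_eq hD (hmem 0 (zero_mem _) 1 (one_mem _))
    exact ⟨n, 0, zero_mem _, 1, one_mem _, by simpa using hc0, hn⟩
  classical
  obtain ⟨x, hx, y, hy, ha0, ha⟩ := Nat.find_spec hP
  set a := x * d - y * c with ha_def
  have hpos : 0 < |σ₁ D a * σ₂ D a| := by
    rw [abs_pos]
    exact mul_ne_zero ((map_ne_zero_iff _ hinj₁).2 ha0) ((map_ne_zero_iff _ hinj₂).2 ha0)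
  obtain ⟨b, hb⟩ := exists_mul_eq_one hsq ha0
  -- By minimality the remainder of approximate division by a vanishes, so some multiple by k ≤ M is
  -- divisible by a; M! is a multiple of every such k.
  have hdiv : ∀ s ∈ quadOrder D, ∀ t ∈ quadOrder D, ∃ w ∈ quadOrder D,
      (M.factorial : QuadField D) * (s * d - t * c) = a * w := by
    intro s hs t ht
    obtain ⟨k, hk0, hkM, w, hw, h1, h2⟩ := hM ((s * d - t * c) * b)
    have hk : (k : QuadField D) * (s * d - t * c) - w * a = 0 := by
      by_contra hne
      have e1 : ((k : QuadField D) * s - w * x) * d - ((k : QuadField D) * t - w * y) * c =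
          a * ((k : QuadField D) * ((s * d - t * c) * b) - w) := by
        linear_combination -(k : QuadField D) * (s * d - t * c) * hb + w * ha_def
      have e2 : (k : QuadField D) * (s * d - t * c) - w * a =
          ((k : QuadField D) * s - w * x) * d - ((k : QuadField D) * t - w * y) * c := by
        rw [ha_def]
        ring
      have m1 : (k : QuadField D) * s - w * x ∈ quadOrder D :=
        sub_mem (mul_mem (natCast_mem _ _) hs) (mul_mem hw hx)
      have m2 : (k : QuadField D) * t - w * y ∈ quadOrder D :=
        sub_mem (mul_mem (natCast_mem _ _) ht) (mul_mem hw hy)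
      obtain ⟨n, hn⟩ := exists_norm_eq hD (hmem _ m1 _ m2)
      have hle := Nat.find_min' hP ⟨_, m1, _, m2, e2 ▸ hne, hn⟩
      have hle' : |σ₁ D a * σ₂ D a| ≤ n := by rw [ha]; exact_mod_cast hle
      rw [← hn, e1, map_mul, map_mul, mul_mul_mul_comm, abs_mul (σ₁ D a * σ₂ D a)] at hle'
      have hlt : |σ₁ D ((k : QuadField D) * ((s * d - t * c) * b) - w) *
          σ₂ D ((k : QuadField D) * ((s * d - t * c) * b) - w)| < 1 := by
        rw [abs_mul]
        exact mul_lt_one_of_nonneg_of_lt_one_left (abs_nonneg _) h1 h2.le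
      nlinarith
    obtain ⟨l, hl⟩ := Nat.dvd_factorial hk0 hkM
    refine ⟨l * w, mul_mem (natCast_mem _ _) hw, ?_⟩
    rw [hl]
    push_cast
    linear_combination (l : QuadField D) * hk
  obtain ⟨u, hu, hcu⟩ := hdiv 0 (zero_mem _) (-1) (neg_mem (one_mem _))
  obtain ⟨v, hv, hdv⟩ := hdiv 1 (one_mem _) 0 (zero_mem _)
  refine ⟨x, hx, y, hy, u, hu, v, hv, ?_, a, ?_, ?_, ?_⟩
  · linear_combination (M.factorial - (x * v - y * u)) * hb + b * (y * hcu - x * hdv)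
      + b * M.factorial * ha_def
  · rw [ha] at hpos ⊢
    exact_mod_cast hpos
  · linear_combination hcu
  · linear_combination hdv

end Lattice

/-! ### Reduction theory -/

section Reduction

variable {D : ℕ}

theorem smul_upperTriangular {g : SL(2, ℝ)} {A B t : ℝ} (h10 : g 1 0 = 0) (h00 : g 0 0 = A)
    (h11 : g 1 1 = B) (h01 : g 0 1 = t * B) (hAB : A * B = 1) (z : ℍ) :
    (g • z).re = A ^ 2 * z.re + t ∧ (g • z).im = A ^ 2 * z.im := by
  have h : ((g • z : ℍ) : ℂ) = A ^ 2 * z + t := by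
    rw [UpperHalfPlane.coe_specialLinearGroup_apply]
    simp only [Algebra.algebraMap_self, RingHom.id_apply, h10, h00, h11, h01]
    have hB : (B : ℂ) ≠ 0 := by
      rintro h0
      have : B = 0 := by exact_mod_cast h0
      rw [this, mul_zero] at hAB
      exact zero_ne_one hAB
    have hAB' : (A : ℂ) * B = 1 := by exact_mod_cast hAB
    rw [div_eq_iff (by simpa using hB)]
    push_cast
    linear_combination -(A : ℂ) * z * hAB'
  rw [← UpperHalfPlane.coe_re, ← UpperHalfPlane.coe_im, h]
  simp [pow_two]

theorem im_smul_eq_div (g : SL(2, ℝ)) (z : ℍ) :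
    (g • z).im = z.im / ((g 1 0 * z.re + g 1 1) ^ 2 + (g 1 0 * z.im) ^ 2) := by
  have h : (g • z).im = _ :=
    UpperHalfPlane.im_smul_eq_div_normSq (Matrix.SpecialLinearGroup.mapGL ℝ g) z
  have hd : Complex.normSq (UpperHalfPlane.denom (Matrix.SpecialLinearGroup.mapGL ℝ g) z) =
      (g 1 0 * z.re + g 1 1) ^ 2 + (g 1 0 * z.im) ^ 2 := by
    simp [UpperHalfPlane.denom, Complex.normSq_apply]
    ring
  rw [hd] at h
  simpa using h

/-- The order has a unit `η` with `η > 1` in the first and `η⁻¹` in the second embedding. -/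
theorem exists_unit (hD : IsDiscriminant D) (hsq : ¬ IsSquare D) :
    ∃ η : (quadOrder D)ˣ, 1 < σ₁ D ((η : quadOrder D) : QuadField D) ∧
      σ₂ D ((η : quadOrder D) : QuadField D) = (σ₁ D ((η : quadOrder D) : QuadField D))⁻¹ := by
  have hsq' : ¬ IsSquare (D : ℤ) := by rwa [Int.isSquare_natCast_iff]
  -- A Pell solution gives a unit of norm 1; taking absolute values of x and y makes it larger than
  -- 1.
  obtain ⟨x, y, hxy, hy⟩ := Pell.exists_of_not_isSquare (by exact_mod_cast hD.1) hsq'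
  have hx1 : (1 : ℤ) ≤ |x| := by
    refine Int.one_le_abs ?_
    rintro rfl
    have : 0 < (D : ℤ) := by exact_mod_cast hD.1
    nlinarith [sq_nonneg y]
  have hy1 : (1 : ℤ) ≤ |y| := Int.one_le_abs hy
  have hxy' : |x| ^ 2 - D * |y| ^ 2 = 1 := by rwa [sq_abs, sq_abs]
  generalize |x| = x' at *
  generalize |y| = y' at *
  have hK : (x' : QuadField D) ^ 2 - D * (y' : QuadField D) ^ 2 = 1 := by
    exact_mod_cast congrArg (Int.cast : ℤ → QuadField D) hxy'
  have hs := sqrtD_mul_self (D := D)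
  let η : (quadOrder D)ˣ := ⟨(x' : quadOrder D) + (y' : quadOrder D) * ⟨sqrtD D, sqrtD_mem⟩,
    (x' : quadOrder D) - (y' : quadOrder D) * ⟨sqrtD D, sqrtD_mem⟩,
    Subtype.ext (by push_cast; linear_combination hK - (y' : QuadField D) ^ 2 * hs),
    Subtype.ext (by push_cast; linear_combination hK - (y' : QuadField D) ^ 2 * hs)⟩
  have e1 : σ₁ D ((η : quadOrder D) : QuadField D) = x' + y' * √(D : ℝ) := by
    rw [σ₁_apply]
    simp [η, sqrtD]
  have e2 : σ₂ D ((η : quadOrder D) : QuadField D) = x' - y' * √(D : ℝ) := by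
    rw [σ₂_apply]
    simp [η, sqrtD]
  have hD1 : (1 : ℝ) ≤ √(D : ℝ) := Real.one_le_sqrt.2 (by exact_mod_cast hD.1)
  have hx'' : (1 : ℝ) ≤ x' := by exact_mod_cast hx1
  have hy'' : (1 : ℝ) ≤ y' := by exact_mod_cast hy1
  have hR : (x' : ℝ) ^ 2 - D * (y' : ℝ) ^ 2 = 1 := by exact_mod_cast hxy'
  refine ⟨η, ?_, ?_⟩
  · rw [e1]
    nlinarith
  · refine eq_inv_of_mul_eq_one_left ?_
    rw [e1, e2]
    have := Real.mul_self_sqrt (Nat.cast_nonneg (α := ℝ) D)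
    linear_combination hR - (y' : ℝ) ^ 2 * this

/-- The matrix diag(η⁻ⁿ, ηⁿ) keeps the product of the imaginary parts and divides their ratio by
l⁴ⁿ, where l = σ₁(η); so the ratio can be brought into [1, l⁴]. Translation by the lattice 𝓞_D
bounds the real parts. -/
theorem exists_balanced (hD : IsDiscriminant D) (hsq : ¬ IsSquare D) : ∃ E : ℝ, 1 ≤ E ∧
    ∀ z : ℍ × ℍ, ∃ g : SL(2, QuadField D), (∀ i j, g i j ∈ quadOrder D) ∧ ∃ w : ℍ × ℍ,
      moebius D g z = w ∧ w.1.im * w.2.im = z.1.im * z.2.im ∧ w.2.im ≤ w.1.im ∧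
      w.1.im ≤ E * w.2.im ∧ |w.1.re| ≤ 1 + D ∧ |w.2.re| ≤ 1 + D := by
  obtain ⟨η, hη, hη'⟩ := exists_unit hD hsq
  set l := σ₁ D ((η : quadOrder D) : QuadField D) with hl
  have hl0 : 0 < l := one_pos.trans hη
  refine ⟨l ^ 4, one_le_pow₀ hη.le, fun z => ?_⟩
  obtain ⟨n, hn1, hn2⟩ := exists_mem_Ico_zpow (x := z.1.im / z.2.im) (y := l ^ 4)
    (div_pos z.1.im_pos z.2.im_pos) (one_lt_pow₀ hη (by norm_num))
  have hmap : ∀ f : QuadField D →+* ℝ, ∀ k : ℤ, f (((η ^ k : (quadOrder D)ˣ) : quadOrder D) :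
      QuadField D) = f ((η : quadOrder D) : QuadField D) ^ k := by
    intro f k
    have := congrArg Units.val
      (map_zpow (Units.map ((f.comp (quadOrder D).val.toRingHom : quadOrder D →+* ℝ) :
        quadOrder D →* ℝ)) η k)
    rw [Units.val_zpow_eq_zpow_val] at this
    exact this
  set A := l ^ (-n) with hA
  set B := l ^ n with hB
  have hAB : A * B = 1 := by rw [hA, hB, ← zpow_add₀ hl0.ne', neg_add_cancel, zpow_zero]
  have hA0 : 0 < A := zpow_pos hl0 _
  have hB0 : 0 < B := zpow_pos hl0 _
  set a : QuadField D := (((η ^ (-n) : (quadOrder D)ˣ) : quadOrder D) : QuadField D) with ha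
  set b : QuadField D := (((η ^ n : (quadOrder D)ˣ) : quadOrder D) : QuadField D) with hb
  have hab : a * b = 1 := by
    rw [ha, hb, ← MulMemClass.coe_mul, ← Units.val_mul, ← zpow_add, neg_add_cancel, zpow_zero]
    rfl
  have a1 : σ₁ D a = A := hmap _ _
  have b1 : σ₁ D b = B := hmap _ _
  have a2 : σ₂ D a = B := by rw [hmap, hη', hB, inv_zpow', neg_neg]
  have b2 : σ₂ D b = A := by rw [hmap, hη', hA, inv_zpow']
  obtain ⟨d, hd, hd1, hd2⟩ := exists_add_mem_quadOrder_le hD (A ^ 2 * z.1.re) (B ^ 2 * z.2.re)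
  let g : SL(2, QuadField D) := ⟨!![a, d * b; 0, b], by simp [hab]⟩
  have g1 := smul_upperTriangular (g := Matrix.SpecialLinearGroup.map (σ₁ D) g) (A := A) (B := B)
    (t := σ₁ D d) (map_zero (σ₁ D)) a1 b1 ((map_mul (σ₁ D) d b).trans (by rw [b1])) hAB z.1
  have g2 := smul_upperTriangular (g := Matrix.SpecialLinearGroup.map (σ₂ D) g) (A := B) (B := A)
    (t := σ₂ D d) (map_zero (σ₂ D)) a2 b2 ((map_mul (σ₂ D) d b).trans (by rw [b2]))
    (by rw [mul_comm, hAB]) z.2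
  refine ⟨g, ?_, _, moebius_apply g z, ?_, ?_, ?_, ?_, ?_⟩
  · intro i j
    fin_cases i <;> fin_cases j
    · exact Subtype.prop _
    · exact mul_mem hd (Subtype.prop _)
    · exact zero_mem _
    · exact Subtype.prop _
  all_goals simp only [g1, g2]
  · linear_combination (A * B + 1) * z.1.im * z.2.im * hAB
  · rw [le_div_iff₀ z.2.im_pos] at hn1
    have e : (l ^ 4) ^ n = B ^ 4 := by
      rw [hB, ← zpow_natCast, ← zpow_natCast, ← zpow_mul, ← zpow_mul, mul_comm]
    rw [e] at hn1
    calc B ^ 2 * z.2.im = A ^ 2 * (B ^ 4 * z.2.im) := by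
          linear_combination -B ^ 2 * z.2.im * (A * B + 1) * hAB
      _ ≤ A ^ 2 * z.1.im := mul_le_mul_of_nonneg_left hn1 (by positivity)
  · rw [div_lt_iff₀ z.2.im_pos] at hn2
    have e : (l ^ 4) ^ (n + 1) = l ^ 4 * B ^ 4 := by
      rw [zpow_add₀ (by positivity), zpow_one, mul_comm, hB, ← zpow_natCast, ← zpow_natCast,
        ← zpow_mul, ← zpow_mul, mul_comm n]
    rw [e] at hn2
    calc A ^ 2 * z.1.im ≤ A ^ 2 * (l ^ 4 * B ^ 4 * z.2.im) :=
          mul_le_mul_of_nonneg_left hn2.le (by positivity)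
      _ = l ^ 4 * (B ^ 2 * z.2.im) := by
          linear_combination l ^ 4 * B ^ 2 * z.2.im * (A * B + 1) * hAB
  · exact hd1
  · exact hd2

theorem mul_apply_mem_of_mem {g h : SL(2, QuadField D)} {a b : QuadField D}
    (hg : ∀ i j, a * g i j ∈ quadOrder D) (hh : ∀ i j, b * h i j ∈ quadOrder D) (i j : Fin 2) :
    a * b * (g * h) i j ∈ quadOrder D := by
  rw [Matrix.SpecialLinearGroup.coe_mul, Matrix.mul_apply, Fin.sum_univ_two]
  convert add_mem (mul_mem (hg i 0) (hh 0 j)) (mul_mem (hg i 1) (hh 1 j)) using 1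
  ring

/-- With T of size Y^(-1/2), both cx + d and cy are O(√Y). -/
theorem normSq_bound {c d x y Y T C E : ℝ} (hY : 0 < Y) (hC : 0 ≤ C)
    (hT1 : 1 / √Y ≤ T) (hT2 : T ≤ 2 / √Y) (hc : |c| ≤ C * T) (hcd : |c * x + d| ≤ C * (1 / T))
    (hy0 : 0 ≤ y) (hy : y ≤ E * Y) :
    (c * x + d) ^ 2 + (c * y) ^ 2 ≤ C ^ 2 * (1 + 4 * E ^ 2) * Y := by
  have hs : 0 < √Y := Real.sqrt_pos.2 hY
  have hss : √Y ^ 2 = Y := Real.sq_sqrt hY.le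
  have hT0 : 0 < T := lt_of_lt_of_le (by positivity) hT1
  have h1 : |c * x + d| ≤ C * √Y := by
    refine hcd.trans (mul_le_mul_of_nonneg_left ?_ hC)
    rw [div_le_iff₀ hT0]
    rw [div_le_iff₀ hs] at hT1
    linarith
  have h2 : |c * y| ≤ 2 * C * E * √Y := by
    rw [abs_mul, abs_of_nonneg hy0]
    calc |c| * y ≤ (C * (2 / √Y)) * (E * Y) := by gcongr; exact hc.trans (by gcongr)
      _ = 2 * C * E * √Y := by
        field_simp
        rw [hss]
        ring
  have h3 : (c * x + d) ^ 2 ≤ (C * √Y) ^ 2 := sq_le_sq' (by linarith [abs_le.1 h1]) (abs_le.1 h1).2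
  have h4 : (c * y) ^ 2 ≤ (2 * C * E * √Y) ^ 2 :=
    sq_le_sq' (by linarith [abs_le.1 h2]) (abs_le.1 h2).2
  calc _ ≤ (C * √Y) ^ 2 + (2 * C * E * √Y) ^ 2 := add_le_add h3 h4
    _ = C ^ 2 * (1 + 4 * E ^ 2) * √Y ^ 2 := by ring
    _ = _ := by rw [hss]

/-- Balanced points close to the boundary can be moved away from it by a matrix with entries of
bounded denominator. -/
theorem exists_le_im_mul_im (hD : IsDiscriminant D) (hsq : ¬ IsSquare D) {E : ℝ} (hE : 1 ≤ E) :
    ∃ m : ℕ, 0 < m ∧ ∃ κ : ℝ, 0 < κ ∧ ∀ w : ℍ × ℍ, w.2.im < 1 → w.2.im ≤ w.1.im →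
      w.1.im ≤ E * w.2.im → ∃ g : SL(2, QuadField D),
      (∀ i j, (m : QuadField D) * g i j ∈ quadOrder D) ∧
      κ ≤ (moebius D g w).1.im * (moebius D g w).2.im := by
  obtain ⟨m, hm, hcomp⟩ := exists_completion hD hsq
  have hm' : (0 : ℝ) < m := by exact_mod_cast hm
  have hE0 : 0 < E := one_pos.trans_le hE
  set Q : ℝ := (1 + D : ℝ) ^ 2 * (1 + 4 * E ^ 2) with hQ
  have hQ0 : 0 < Q := by positivity
  refine ⟨m, hm, 1 / (m ^ 4 * Q ^ 2), by positivity, fun w hsmall hw21 hw12 => ?_⟩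
  have hY := w.2.im_pos
  have hs : 0 < √w.2.im := Real.sqrt_pos.2 hY
  have hs1 : √w.2.im ≤ 1 := Real.sqrt_le_one.2 hsmall.le
  set T : ℕ := ⌈1 / √w.2.im⌉₊ with hT
  have hT1 : 1 / √w.2.im ≤ T := Nat.le_ceil _
  have hT0 : 0 < T := Nat.ceil_pos.2 (by positivity)
  have hT2 : (T : ℝ) ≤ 2 / √w.2.im := by
    have h1 := Nat.ceil_lt_add_one (a := 1 / √w.2.im) (by positivity)
    have h2 : 1 ≤ 1 / √w.2.im := by rwa [le_div_iff₀ hs, one_mul]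
    have h3 : 2 / √w.2.im = 1 / √w.2.im + 1 / √w.2.im := by ring
    rw [h3]
    exact h1.le.trans (by linarith)
  obtain ⟨c, hc, d, hd, hc0, hc1, hc2, hcd1, hcd2⟩ :=
    exists_approximation hD w.1.re w.2.re hT0
  obtain ⟨x, hx, y, hy, u, hu, v, hv, hdet, a, ha, hcu, hdv⟩ := hcomp c hc d hd hc0
  have hC : (0 : ℝ) ≤ 1 + D := by positivity
  have q1 := normSq_bound hY hC hT1 hT2 hc1 hcd1 w.1.im_pos.le hw12
  have q2 := normSq_bound hY hC hT1 hT2 hc2 hcd2 hY.le (le_mul_of_one_le_left hY.le hE)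
  obtain ⟨b, hb⟩ := exists_mul_eq_one hsq (x := (m : QuadField D)) (by exact_mod_cast hm.ne')
  -- The completed matrix has determinant m; dividing its top row by m leaves (u, v), proportional
  -- to (c, d), as bottom row.
  let g : SL(2, QuadField D) := ⟨!![b * x, b * y; u, v], by
    rw [Matrix.det_fin_two_of]
    linear_combination b * hdet + hb⟩
  have hg : ∀ i j, (m : QuadField D) * g i j ∈ quadOrder D := by
    intro i j
    fin_cases i <;> fin_cases j
    · change (m : QuadField D) * (b * x) ∈ _
      rwa [← mul_assoc, hb, one_mul]
    · change (m : QuadField D) * (b * y) ∈ _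
      rwa [← mul_assoc, hb, one_mul]
    · exact mul_mem (natCast_mem _ _) hu
    · exact mul_mem (natCast_mem _ _) hv
  refine ⟨g, hg, ?_⟩
  have i1 : (moebius D g w).1.im = w.1.im /
      ((σ₁ D u * w.1.re + σ₁ D v) ^ 2 + (σ₁ D u * w.1.im) ^ 2) := by
    rw [moebius_apply, im_smul_eq_div]
    rfl
  have i2 : (moebius D g w).2.im = w.2.im /
      ((σ₂ D u * w.2.re + σ₂ D v) ^ 2 + (σ₂ D u * w.2.im) ^ 2) := by
    rw [moebius_apply, im_smul_eq_div]
    rfl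
  have hcu1 : (m : ℝ) * σ₁ D c = σ₁ D a * σ₁ D u := by simpa using congrArg (σ₁ D) hcu
  have hcu2 : (m : ℝ) * σ₂ D c = σ₂ D a * σ₂ D u := by simpa using congrArg (σ₂ D) hcu
  have hdv1 : (m : ℝ) * σ₁ D d = σ₁ D a * σ₁ D v := by simpa using congrArg (σ₁ D) hdv
  have hdv2 : (m : ℝ) * σ₂ D d = σ₂ D a * σ₂ D v := by simpa using congrArg (σ₂ D) hdv
  have e1 : (m : ℝ) ^ 2 * ((σ₁ D c * w.1.re + σ₁ D d) ^ 2 + (σ₁ D c * w.1.im) ^ 2) =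
      σ₁ D a ^ 2 * ((σ₁ D u * w.1.re + σ₁ D v) ^ 2 + (σ₁ D u * w.1.im) ^ 2) := by
    have f1 : (m : ℝ) * (σ₁ D c * w.1.re + σ₁ D d) = σ₁ D a * (σ₁ D u * w.1.re + σ₁ D v) := by
      linear_combination w.1.re * hcu1 + hdv1
    have f2 : (m : ℝ) * (σ₁ D c * w.1.im) = σ₁ D a * (σ₁ D u * w.1.im) := by
      linear_combination w.1.im * hcu1
    rw [mul_add, ← mul_pow, ← mul_pow, f1, f2]
    ring
  have e2 : (m : ℝ) ^ 2 * ((σ₂ D c * w.2.re + σ₂ D d) ^ 2 + (σ₂ D c * w.2.im) ^ 2) =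
      σ₂ D a ^ 2 * ((σ₂ D u * w.2.re + σ₂ D v) ^ 2 + (σ₂ D u * w.2.im) ^ 2) := by
    have f1 : (m : ℝ) * (σ₂ D c * w.2.re + σ₂ D d) = σ₂ D a * (σ₂ D u * w.2.re + σ₂ D v) := by
      linear_combination w.2.re * hcu2 + hdv2
    have f2 : (m : ℝ) * (σ₂ D c * w.2.im) = σ₂ D a * (σ₂ D u * w.2.im) := by
      linear_combination w.2.im * hcu2
    rw [mul_add, ← mul_pow, ← mul_pow, f1, f2]
    ring
  have p1 := (moebius D g w).1.im_pos
  have p2 := (moebius D g w).2.im_pos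
  rw [i1] at p1
  rw [i2] at p2
  rw [i1, i2]
  set n₁ := (σ₁ D u * w.1.re + σ₁ D v) ^ 2 + (σ₁ D u * w.1.im) ^ 2
  set n₂ := (σ₂ D u * w.2.re + σ₂ D v) ^ 2 + (σ₂ D u * w.2.im) ^ 2
  set r₁ := (σ₁ D c * w.1.re + σ₁ D d) ^ 2 + (σ₁ D c * w.1.im) ^ 2
  set r₂ := (σ₂ D c * w.2.re + σ₂ D d) ^ 2 + (σ₂ D c * w.2.im) ^ 2
  have n1pos : 0 < n₁ := (div_pos_iff_of_pos_left w.1.im_pos).1 p1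
  have n2pos : 0 < n₂ := (div_pos_iff_of_pos_left w.2.im_pos).1 p2
  have hr : r₁ * r₂ ≤ Q ^ 2 * (w.1.im * w.2.im) := by
    calc r₁ * r₂ ≤ (Q * w.2.im) * (Q * w.2.im) :=
          mul_le_mul q1 q2 (by positivity) (by positivity)
      _ = Q ^ 2 * (w.2.im * w.2.im) := by ring
      _ ≤ Q ^ 2 * (w.1.im * w.2.im) := by gcongr
  -- Passing from (c, d) to (u, v) costs at most m⁴, since the norm of a is at least 1 in absolute
  -- value.
  have hn : n₁ * n₂ ≤ m ^ 4 * (Q ^ 2 * (w.1.im * w.2.im)) := by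
    have ha2 : 1 ≤ (σ₁ D a * σ₂ D a) ^ 2 := by
      rw [← sq_abs]
      exact one_le_pow₀ ha
    calc n₁ * n₂ ≤ (σ₁ D a * σ₂ D a) ^ 2 * (n₁ * n₂) := le_mul_of_one_le_left (by positivity) ha2
      _ = (σ₁ D a ^ 2 * n₁) * (σ₂ D a ^ 2 * n₂) := by ring
      _ = m ^ 4 * (r₁ * r₂) := by rw [← e1, ← e2]; ring
      _ ≤ _ := by gcongr
  rw [div_mul_div_comm, div_le_div_iff₀ (by positivity) (by positivity)]
  linarith

/-- Every point of `ℍ²` can be moved into a fixed Siegel set by a matrix with entries of bounded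
denominator. -/
theorem exists_reduction (hD : IsDiscriminant D) (hsq : ¬ IsSquare D) : ∃ m : ℕ, 0 < m ∧
    ∃ κ : ℝ, 0 < κ ∧ ∀ z : ℍ × ℍ, ∃ g : SL(2, QuadField D),
      (∀ i j, (m : QuadField D) * g i j ∈ quadOrder D) ∧ ∃ w : ℍ × ℍ, moebius D g z = w ∧
      (|w.1.re| ≤ 1 + D ∧ κ ≤ w.1.im) ∧ |w.2.re| ≤ 1 + D ∧ κ ≤ w.2.im := by
  obtain ⟨E, hE, hbal⟩ := exists_balanced hD hsq
  obtain ⟨m, hm, κ₀, hκ₀, hstep⟩ := exists_le_im_mul_im hD hsq hE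
  have hE0 : 0 < E := one_pos.trans_le hE
  refine ⟨m, hm, min 1 √(κ₀ / E), lt_min one_pos (Real.sqrt_pos.2 (by positivity)), fun z => ?_⟩
  obtain ⟨S, hS, w, hSw, -, hw21, hw12, hwr1, hwr2⟩ := hbal z
  by_cases hbig : 1 ≤ w.2.im
  · exact ⟨S, fun i j => mul_mem (natCast_mem _ _) (hS i j), w, hSw,
      ⟨hwr1, (min_le_left _ _).trans (hbig.trans hw21)⟩, hwr2, (min_le_left _ _).trans hbig⟩
  obtain ⟨g, hg, hκ⟩ := hstep w (not_le.1 hbig) hw21 hw12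
  -- Balancing again turns the lower bound on the product of the imaginary parts into one on each of
  -- them.
  obtain ⟨S', hS', w', hSw', hprod, hw21', hw12', hwr1', hwr2'⟩ := hbal (moebius D g w)
  rw [← hprod] at hκ
  have hlow : √(κ₀ / E) ≤ w'.2.im := by
    rw [Real.sqrt_le_left w'.2.im_pos.le, div_le_iff₀ hE0]
    have := w'.2.im_pos
    nlinarith
  refine ⟨S' * (g * S), ?_, w', ?_, ⟨hwr1', ?_⟩, hwr2', ?_⟩
  · intro i j
    have hS1 : ∀ i j, 1 * S i j ∈ quadOrder D := fun i j => by rw [one_mul]; exact hS i j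
    have hS1' : ∀ i j, 1 * S' i j ∈ quadOrder D := fun i j => by rw [one_mul]; exact hS' i j
    have h2 := mul_apply_mem_of_mem hS1' (mul_apply_mem_of_mem hg hS1) i j
    rwa [one_mul, mul_one] at h2
  · rw [map_mul, map_mul, Equiv.Perm.mul_apply, Equiv.Perm.mul_apply, hSw, hSw']
  · exact (min_le_right _ _).trans (hlow.trans hw21')
  · exact (min_le_right _ _).trans hlow

end Reduction

/-! ### Measure of Siegel sets -/

section SiegelSet

/-- A vertical strip in the upper half-plane, bounded away from the real axis. -/
def siegelStrip (R κ : ℝ) : Set ℍ := {z | |z.re| ≤ R ∧ κ ≤ z.im}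

theorem measurableSet_siegelStrip (R κ : ℝ) : MeasurableSet (siegelStrip R κ) :=
  ((isClosed_le (continuous_abs.comp UpperHalfPlane.continuous_re) continuous_const).inter
    (isClosed_le continuous_const UpperHalfPlane.continuous_im)).measurableSet

/-- The strip has bounded width, and ∫ dy/y² over y ≥ κ converges. -/
theorem volume_siegelStrip_lt_top {R κ : ℝ} (hκ : 0 < κ) :
    volume (siegelStrip R κ) < ⊤ := by
  have hf : Measurable fun y : ℝ => (((1 / ‖y‖₊) ^ 2 : NNReal) : ENNReal) := by fun_prop
  have hsub : UpperHalfPlane.coe '' siegelStrip R κ ⊆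
      Complex.measurableEquivRealProd ⁻¹' (Set.Icc (-R) R ×ˢ Set.Ici κ) := by
    rintro _ ⟨z, ⟨h1, h2⟩, rfl⟩
    exact ⟨abs_le.1 h1, h2⟩
  rw [UpperHalfPlane.volume_eq_lintegral]
  refine (lintegral_mono_set hsub).trans_lt ?_
  have hmp := Complex.volume_preserving_equiv_real_prod
  have hcomp := hmp.setLIntegral_comp_preimage_emb
    Complex.measurableEquivRealProd.measurableEmbedding
    (fun w : ℝ × ℝ => (((1 / ‖w.2‖₊) ^ 2 : NNReal) : ENNReal)) (Set.Icc (-R) R ×ˢ Set.Ici κ)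
  refine (le_of_eq hcomp).trans_lt ?_
  rw [Measure.volume_eq_prod, ← Measure.prod_restrict]
  have := lintegral_prod_mul (μ := volume.restrict (Set.Icc (-R) R))
    (ν := volume.restrict (Set.Ici κ)) (f := fun _ => 1)
    (g := fun y : ℝ => (((1 / ‖y‖₊) ^ 2 : NNReal) : ENNReal)) aemeasurable_const hf.aemeasurable
  simp only [one_mul] at this
  rw [this]
  refine ENNReal.mul_lt_top (by simp) ?_
  rw [setLIntegral_congr (Ioi_ae_eq_Ici (a := κ)).symm]
  have hint := (integrableOn_Ioi_rpow_of_lt (a := -2) (by norm_num) hκ).hasFiniteIntegral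
  refine lt_of_le_of_lt (le_of_eq ?_) hint
  refine setLIntegral_congr_fun measurableSet_Ioi fun y hy => ?_
  have hy0 : 0 < y := hκ.trans hy
  simp only [enorm_eq_nnnorm, ENNReal.coe_inj]
  rw [Real.nnnorm_rpow_of_nonneg hy0.le]
  ext
  simp

theorem volume_univ_upperHalfPlane_ne_zero : (volume : Measure ℍ) Set.univ ≠ 0 := by
  intro h
  rw [UpperHalfPlane.volume_def] at h
  have hac := withDensity_absolutelyContinuous' (μ := volume.comap UpperHalfPlane.coe)
    (f := fun z : ℍ => (((1 / NNReal.mk z.im z.im_pos.le : NNReal) ^ 2 : NNReal) : ENNReal)) ?_ ?_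
  · have h1 := hac h
    rw [UpperHalfPlane.measurableEmbedding_coe.comap_apply, Set.image_univ] at h1
    exact UpperHalfPlane.isOpenEmbedding_coe.isOpen_range.measure_ne_zero _
      (Set.range_nonempty _) h1
  · refine Measurable.aemeasurable ?_
    refine Measurable.coe_nnreal_ennreal (Measurable.pow_const (measurable_const.div ?_) 2)
    exact UpperHalfPlane.continuous_im.measurable.subtype_mk
  · refine Filter.Eventually.of_forall fun z => ?_
    have : NNReal.mk z.im z.im_pos.le ≠ 0 := fun h => z.im_ne_zero (congrArg NNReal.toReal h)
    exact ENNReal.coe_ne_zero.2 (pow_ne_zero 2 (div_ne_zero one_ne_zero this))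

theorem eulerMeasure_ne_zero : eulerMeasure ≠ 0 := by
  intro h
  have h1 : eulerMeasure (Set.univ ×ˢ Set.univ) = 0 := by rw [h]; rfl
  rw [eulerMeasure, Measure.prod_prod, mul_self_eq_zero, Measure.smul_apply, smul_eq_mul,
    mul_eq_zero] at h1
  rcases h1 with h1 | h1
  · rw [ENNReal.ofReal_eq_zero] at h1
    have := Real.pi_pos
    have : 0 < 1 / (2 * Real.pi) := by positivity
    linarith
  · exact volume_univ_upperHalfPlane_ne_zero h1

theorem eulerMeasure_siegelSet_lt_top {R κ : ℝ} (hκ : 0 < κ) :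
    eulerMeasure (siegelStrip R κ ×ˢ siegelStrip R κ) < ⊤ := by
  rw [eulerMeasure, Measure.prod_prod, Measure.smul_apply]
  have := ENNReal.mul_lt_top (ENNReal.ofReal_lt_top (r := 1 / (2 * Real.pi)))
    (volume_siegelStrip_lt_top (R := R) hκ)
  exact ENNReal.mul_lt_top this this

end SiegelSet

/-! ### Covolumes and their ratio -/

section Covolume

variable {D : ℕ}

theorem exists_residueClass (hD : IsDiscriminant D) (n : ℕ) :
    ∃ ρ : quadOrder D → ZMod n × ZMod n, ∀ x y, ρ x = ρ y →
      ∃ k ∈ quadOrder D, (x : QuadField D) - y = n * k := by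
  choose u v huv using fun x : quadOrder D => (mem_quadOrder_iff hD).1 x.2
  refine ⟨fun x => (u x, v x), fun x y hxy => ?_⟩
  simp only [Prod.mk.injEq] at hxy
  obtain ⟨⟨s, hs⟩, ⟨t, ht⟩⟩ : (n : ℤ) ∣ u x - u y ∧ (n : ℤ) ∣ v x - v y := by
    rw [← ZMod.intCast_zmod_eq_zero_iff_dvd, ← ZMod.intCast_zmod_eq_zero_iff_dvd]
    push_cast
    rw [hxy.1, hxy.2, sub_self, sub_self]
    exact ⟨rfl, rfl⟩
  have hs' : (u x : QuadField D) - u y = n * s := by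
    exact_mod_cast congrArg (Int.cast : ℤ → QuadField D) hs
  have ht' : (v x : QuadField D) - v y = n * t := by
    exact_mod_cast congrArg (Int.cast : ℤ → QuadField D) ht
  refine ⟨_, (mem_quadOrder_iff hD).2 ⟨s, t, rfl⟩, ?_⟩
  rw [huv x, huv y]
  linear_combination hs' + gammaD D * ht'

theorem mul_inv_apply_diag (g h : SL(2, QuadField D)) :
    (g * h⁻¹) 0 0 = g 0 0 * h 1 1 - g 0 1 * h 1 0 ∧
      (g * h⁻¹) 1 1 = g 1 1 * h 0 0 - g 1 0 * h 0 1 := by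
  constructor <;>
  · rw [Matrix.SpecialLinearGroup.coe_mul, Matrix.mul_apply, Fin.sum_univ_two,
      Matrix.SpecialLinearGroup.SL2_inv_expl]
    simp
    ring

/-- Matrices with denominator `m` that are congruent modulo `m² D` differ by an element of the
Hilbert modular group. -/
theorem mul_inv_mem_of_congruent (hsq : ¬ IsSquare D) {m : ℕ} (hm : 0 < m)
    {g h : SL(2, QuadField D)} (hh : ∀ i j, (m : QuadField D) * h i j ∈ quadOrder D)
    (hgh : ∀ i j, ∃ k ∈ quadOrder D,
      (m : QuadField D) * g i j - (m : QuadField D) * h i j = (m ^ 2 * D : ℕ) * k) :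
    g * h⁻¹ ∈ hilbertModularGroup (⊤ : Ideal (quadOrder D)) := by
  choose k hk hgk using hgh
  obtain ⟨b, hb⟩ := exists_mul_eq_one hsq (x := (m : QuadField D)) (by exact_mod_cast hm.ne')
  -- In m²D one factor m clears the denominator of g - h, the other that of h; the factor D provides
  -- the powers of √D required off the diagonal.
  have key : ∀ i j i' j', g i j * h i' j' = h i j * h i' j' + D * (k i j * (m * h i' j')) := by
    intro i j i' j'
    have h1 := hgk i j
    push_cast at h1
    linear_combination b * h i' j' * h1 -
      (g i j - h i j - m * D * k i j) * h i' j' * hb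
  have hkm : ∀ i j i' j', k i j * ((m : QuadField D) * h i' j') ∈ quadOrder D :=
    fun i j i' j' => mul_mem (hk i j) (hh i' j')
  have hdet := det_eq_one h
  have hsD := sqrtD_mul_self (D := D)
  have hDm : (D : QuadField D) ∈ quadOrder D := natCast_mem _ D
  refine ⟨?_, ?_, ⟨⟨sqrtD D * (k 0 1 * (m * h 0 0) - k 0 0 * (m * h 0 1)),
    mul_mem sqrtD_mem (sub_mem (hkm _ _ _ _) (hkm _ _ _ _))⟩, trivial, ?_⟩, fun y _ => ?_⟩
  · rw [(mul_inv_apply_diag g h).1, key, key]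
    convert add_mem (one_mem _) (mul_mem hDm (sub_mem (hkm 0 0 1 1) (hkm 0 1 1 0))) using 1
    linear_combination hdet
  · rw [(mul_inv_apply_diag g h).2, key, key]
    convert add_mem (one_mem _) (mul_mem hDm (sub_mem (hkm 1 1 0 0) (hkm 1 0 0 1))) using 1
    linear_combination hdet
  · rw [(mul_inv_apply g h).1, key, key]
    simp only
    linear_combination -(k 0 1 * (m * h 0 0) - k 0 0 * (m * h 0 1)) * hsD
  · rw [(mul_inv_apply g h).2, key, key]
    convert mul_mem (mul_mem sqrtD_mem
      (mul_mem hDm (sub_mem (hkm 1 0 1 1) (hkm 1 1 1 0)))) y.2 using 1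
    ring

/-- If g moves z to w in the Siegel set and δ is the chosen representative congruent to g⁻¹, then δg
lies in the modular group and moves z to δw. Finitely many δ suffice. -/
theorem exists_covering_set (hD : IsDiscriminant D) (hsq : ¬ IsSquare D) :
    ∃ t : Set (ℍ × ℍ), eulerMeasure t < ⊤ ∧
      ∀ z, ∃ g : transformationGroup (⊤ : Ideal (quadOrder D)), g • z ∈ t := by
  obtain ⟨m, hm, κ, hκ, hred⟩ := exists_reduction hD hsq
  obtain ⟨ρ, hρ⟩ := exists_residueClass hD (m ^ 2 * D)
  have : NeZero (m ^ 2 * D) := ⟨(Nat.mul_pos (pow_pos hm 2) hD.1).ne'⟩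
  let Δ := {g : SL(2, QuadField D) // ∀ i j, (m : QuadField D) * g i j ∈ quadOrder D}
  let cl : Δ → Fin 2 → Fin 2 → ZMod (m ^ 2 * D) × ZMod (m ^ 2 * D) :=
    fun g i j => ρ ⟨_, g.2 i j⟩
  set S := siegelStrip (1 + D) κ ×ˢ siegelStrip (1 + D) κ with hS
  have hSm : MeasurableSet S :=
    (measurableSet_siegelStrip _ _).prod (measurableSet_siegelStrip _ _)
  have hfin : Finite (Set.range cl) := inferInstance
  have := Fintype.ofFinite (Set.range cl)
  refine ⟨⋃ c : Set.range cl, moebius D (Set.rangeSplitting cl c).1 '' S, ?_, fun z => ?_⟩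
  · refine (measure_iUnion_le _).trans_lt ?_
    rw [tsum_fintype]
    refine ENNReal.sum_lt_top.2 fun c _ => ?_
    have himg : moebius D (Set.rangeSplitting cl c).1 '' S =
        moebius D (Set.rangeSplitting cl c).1⁻¹ ⁻¹' S := by
      rw [map_inv, Equiv.image_eq_preimage_symm]
      rfl
    rw [himg, (measurePreserving_moebius _).measure_preimage hSm.nullMeasurableSet]
    exact eulerMeasure_siegelSet_lt_top hκ
  · obtain ⟨g, hg, w, hgz, hw⟩ := hred z
    have hg' : ∀ i j, (m : QuadField D) * g⁻¹ i j ∈ quadOrder D := by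
      intro i j
      rw [Matrix.SpecialLinearGroup.SL2_inv_expl]
      fin_cases i <;> fin_cases j
      · exact hg 1 1
      · simpa using hg 0 1
      · simpa using hg 1 0
      · exact hg 0 0
    let δ : Δ := Set.rangeSplitting cl ⟨_, ⟨⟨g⁻¹, hg'⟩, rfl⟩⟩
    have hδ : cl δ = cl ⟨g⁻¹, hg'⟩ := Set.apply_rangeSplitting cl _
    have hmem : δ.1 * g⁻¹⁻¹ ∈ hilbertModularGroup (⊤ : Ideal (quadOrder D)) :=
      mul_inv_mem_of_congruent hsq hm hg' fun i j => hρ _ _ (congrFun (congrFun hδ i) j)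
    refine ⟨⟨_, Subgroup.mem_map_of_mem (moebius D) hmem⟩,
      Set.mem_iUnion.2 ⟨⟨_, ⟨⟨g⁻¹, hg'⟩, rfl⟩⟩, w, hw, ?_⟩⟩
    change moebius D δ.1 w = moebius D (δ.1 * g⁻¹⁻¹) z
    rw [inv_inv, map_mul, Equiv.Perm.mul_apply, hgz]

theorem covolume_top_ne_zero (hD : IsDiscriminant D) (hsq : ¬ IsSquare D) :
    covolume (transformationGroup (⊤ : Ideal (quadOrder D))) (ℍ × ℍ) eulerMeasure ≠ 0 ∧
    covolume (transformationGroup (⊤ : Ideal (quadOrder D))) (ℍ × ℍ) eulerMeasure ≠ ⊤ := by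
  obtain ⟨s, hs⟩ := exists_isFundamentalDomain hD hsq (𝔞 := ⊤) one_ne_zero trivial
  rw [hs.covolume_eq_volume]
  refine ⟨hs.measure_ne_zero eulerMeasure_ne_zero, ?_⟩
  obtain ⟨t, ht, hcov⟩ := exists_covering_set hD hsq
  exact ((measure_le_of_forall_exists_smul_mem hs hcov).trans_lt ht).ne

/-- Covolumes of commensurable Hilbert modular groups. -/
theorem mul_covolume_eq (hD : IsDiscriminant D) (hsq : ¬ IsSquare D) {𝔞 𝔠 : Ideal (quadOrder D)}
    {n : ℤ} (hn0 : n ≠ 0) (ha : (n : quadOrder D) ∈ 𝔞) (hc : (n : quadOrder D) ∈ 𝔠) {k l : ℕ}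
    (hk : HasCosetReps (hilbertModularGroup 𝔞 ⊓ hilbertModularGroup 𝔠) (hilbertModularGroup 𝔞) k)
    (hl : HasCosetReps (hilbertModularGroup 𝔞 ⊓ hilbertModularGroup 𝔠) (hilbertModularGroup 𝔠) l) :
    k * covolume (transformationGroup 𝔞) (ℍ × ℍ) eulerMeasure =
      l * covolume (transformationGroup 𝔠) (ℍ × ℍ) eulerMeasure := by
  obtain ⟨s, hs⟩ := exists_isFundamentalDomain hD hsq hn0 ha
  obtain ⟨t, ht⟩ := exists_isFundamentalDomain hD hsq hn0 hc
  rw [hs.covolume_eq_volume, ht.covolume_eq_volume]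
  have hker : (moebius D).ker ≤ hilbertModularGroup 𝔞 ⊓ hilbertModularGroup 𝔠 :=
    le_inf (ker_moebius_le hsq 𝔞) (ker_moebius_le hsq 𝔠)
  obtain ⟨r, hr, hex, huniq⟩ := hk
  obtain ⟨r', hr', hex', huniq'⟩ := hl
  obtain ⟨s', hs', hss'⟩ := exists_isFundamentalDomain_subgroup (moebius D) inf_le_left hker
    (fun g _ => measurePreserving_moebius g) r hr hex huniq hs
  obtain ⟨t', ht', htt'⟩ := exists_isFundamentalDomain_subgroup (moebius D) inf_le_right hker
    (fun g _ => measurePreserving_moebius g) r' hr' hex' huniq' ht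
  rw [Fintype.card_fin] at hss' htt'
  rw [← hss', ← htt']
  -- Both are fundamental domains of the common subgroup.
  exact hs'.measure_eq ht'

/-- The two steps 𝓞_D ⊃ 𝔭₂ ⊃ 𝔭₂ ∩ 𝔭₃ are multiplied, eliminating the term for 𝔭₂; 12 = (2 + 1)(3 +
1). -/
theorem mul_eulerChar_eq (hD : IsDiscriminant D) (hsq : ¬ IsSquare D) {f : ℕ}
    (hf : IsConductor D f) {𝔟 : Ideal (quadOrder D)} (h𝔟 : idealNorm 𝔟 = 6) :
    ((if 2 ∣ f then 2 else 3 : ℕ) : ℝ) * ((if 3 ∣ f then 3 else 4 : ℕ) : ℝ) * eulerChar 𝔟 =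
      12 * eulerChar (⊤ : Ideal (quadOrder D)) := by
  obtain ⟨π₂, π₃, rfl⟩ := exists_ringHom_zmod_two_three h𝔟
  have h2 : RingHom.ker π₂ = ⊤ ⊓ RingHom.ker π₂ := (top_inf_eq _).symm
  have l1 := hasCosetReps_inf_left hD π₂ (𝔞 := ⊤) (e := 1) trivial (map_one _)
  have r1 := hasCosetReps_inf_right hD π₂ (𝔞 := ⊤) (e := 1) trivial (map_one _) (f := f)
    fun N r hN hr => two_dvd_conductor_iff hf hN hr
  -- The integer 4 witnesses coprimality: it is 0 modulo 2 and 1 modulo 3.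
  have he : ((4 : ℕ) : quadOrder D) ∈ RingHom.ker π₂ := by
    rw [RingHom.mem_ker, map_natCast]
    rfl
  have he' : π₃ ((4 : ℕ) : quadOrder D) = 1 := by
    rw [map_natCast]
    rfl
  have l2 := hasCosetReps_inf_left hD π₃ he he'
  have r2 := hasCosetReps_inf_right hD π₃ he he' (f := f)
    fun N r hN hr => three_dvd_conductor_iff hf hN hr
  rw [← h2] at l1 r1
  have m2 : ((6 : ℤ) : quadOrder D) ∈ RingHom.ker π₂ := by
    rw [RingHom.mem_ker, map_intCast]
    rfl
  have m3 : ((6 : ℤ) : quadOrder D) ∈ RingHom.ker π₃ := by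
    rw [RingHom.mem_ker, map_intCast]
    rfl
  have c1 := mul_covolume_eq hD hsq (by norm_num) Submodule.mem_top m2 l1 r1
  have c2 := mul_covolume_eq hD hsq (by norm_num) m2 (Ideal.mem_inf.2 ⟨m2, m3⟩) l2 r2
  have c1' := congrArg ENNReal.toReal c1
  have c2' := congrArg ENNReal.toReal c2
  simp only [ENNReal.toReal_mul, ENNReal.toReal_natCast] at c1' c2'
  rw [← eulerChar, ← eulerChar] at c1' c2'
  push_cast at c1' c2' ⊢
  linear_combination -4 * c1' - (if 2 ∣ f then (2 : ℝ) else 3) * c2'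

end Covolume

end HilbertModular

open HilbertModular in
theorem mainTheorem9 (D f : ℕ) (hD : IsDiscriminant D) (hsq : ¬ IsSquare D)
    (hf : IsConductor D f) (𝔟 : Ideal (quadOrder D)) (h𝔟 : idealNorm 𝔟 = 6) :
    (Nat.gcd 6 f = 1 → eulerChar 𝔟 / eulerChar (⊤ : Ideal (quadOrder D)) = 1) ∧
    (Nat.gcd 6 f = 2 → eulerChar 𝔟 / eulerChar (⊤ : Ideal (quadOrder D)) = 3 / 2) ∧
    (Nat.gcd 6 f = 3 → eulerChar 𝔟 / eulerChar (⊤ : Ideal (quadOrder D)) = 4 / 3) ∧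
    (Nat.gcd 6 f = 6 → eulerChar 𝔟 / eulerChar (⊤ : Ideal (quadOrder D)) = 2) := by
  have h0 : eulerChar (⊤ : Ideal (quadOrder D)) ≠ 0 :=
    ENNReal.toReal_ne_zero.2 (covolume_top_ne_zero hD hsq)
  have h := mul_eulerChar_eq hD hsq hf h𝔟
  have h2 : 2 ∣ Nat.gcd 6 f ↔ 2 ∣ f := by rw [Nat.dvd_gcd_iff]; simp
  have h3 : 3 ∣ Nat.gcd 6 f ↔ 3 ∣ f := by rw [Nat.dvd_gcd_iff]; simp
  rw [← if_congr h2 rfl rfl, ← if_congr h3 rfl rfl] at h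
  refine ⟨fun hg => ?_, fun hg => ?_, fun hg => ?_, fun hg => ?_⟩ <;>
  · rw [div_eq_iff h0]
    rw [hg] at h
    norm_num at h
    linarith
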